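/- **Corollary 3.** Let $y = X\beta^*+\varepsilon$ with a fixed design $X\in\mathbb R^{n\times p}$, $n\ge 1$, whose columns are normalized so that $\frac1n\|X_j\|^2\le 1$, and with $\beta^*\in\mathbb R^p$ having support $S^*$ and $s=|S^*|\ge 1$ nonzero entries. The noise variables $\varepsilon_1,\dots,\varepsilon_n$ are i.i.d. with $\mathbb E\exp(t\varepsilon_i)\le\exp(\sigma^2t^2/2)$ for all $t\in\mathbb R$, where $\sigma>0$. Instead of $X$ one observes $Z=X\circ M$ (entrywise product; missing data being a special case), where the random matrix $M$ is independent of $\varepsilon$ and its rows are i.i.d. with mean $\mu_M$, covariance matrix $\Sigma_M$ and sub-Gaussian parameter $\tau^2$, $\tau>0$ (for every unit vector $v$ and every $t$, $\mathbb E\exp(t\langle v,M_i-\mu_M\rangle)\le\exp(\tau^2t^2/2)$). Assume $$\max_{i,j}|X_{ij}|\le c_X,\qquad \max_{i,j}|M_{ij}|\le c_M,\qquad \min_{i,j}(\Sigma_M)_{ij}>0,\qquad \min_j(\mu_M)_j>0. \tag{A}$$ Let $\Sigma=\frac1nX^\top X$, and let $\Sigma_M^\dagger$ be the entrywise reciprocal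 of $\Sigma_M+\mu_M\mu_M^\top$. Put $\widehat\Sigma=\frac1n Z^\top Z\circ\Sigma_M^\dagger$, and let $\widehat\xi$ be $\frac1nZ^\top y$ divided entrywise by $\mu_M$. Fix $\hat\epsilon>0$. With the eigenvalue decomposition $\widehat\Sigma=P\,\mathrm{Diag}(\theta_1,\dots,\theta_p)P^\top$ let $$\tilde Z=\sqrt n\,P\,\mathrm{Diag}\big(\sqrt{\max(\theta_i,\hat\epsilon)}\big)P^\top,\qquad \tilde y=\sqrt n\,P\,\mathrm{Diag}\big(1/\sqrt{\max(\theta_i,\hat\epsilon)}\big)P^\top\widehat\xi .$$ The algorithm (GEP-MSCRA), with parameters $\lambda>0$, $a>1$ and $\phi(t)=\frac{a-1}{a+1}t^2+\frac{2}{a+1}t$, starts from $\rho_0=1$ and some $w^0\in[0,\frac12]^p$. For $k=1,2,\dots$ it computes $$\beta^k=\arg\min_{\beta\in\mathbb R^p}\Big\{\tfrac1{2n}\|\tilde Z\beta-\tilde y\|^2+\lambda\sum_{i=1}^p(1-w_i^{k-1})|\beta_i|\Big\},$$ selects $\rho_k\ge\rho_{k-1}$ if $k\le3$ and sets $\rho_k=\rho_{k-1}$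 if $k>3$, and computes $w_i^k=\arg\min_{0\le t\le1}\{\phi(t)-\rho_k t|\beta_i^k|\}$ for $i=1,\dots,p$. Suppose that $\Sigma$ satisfies the $\kappa$-restricted eigenvalue condition on $$\mathcal C(S^*)=\bigcup_{S\supseteq S^*,\,|S|\le1.5s}\{\beta\in\mathbb R^p:\|\beta_{S^c}\|_1\le3\|\beta_S\|_1\},$$ that is, $\kappa>0$ and $\beta^\top\Sigma\beta\ge\kappa\|\beta\|^2$ for all $\beta\in\mathcal C(S^*)$. Let $$\tilde K=2\big[\hat\epsilon-\min(\lambda_{\min}(\Sigma_M^\dagger),0)\,c_M^2\big]\|\beta^*\|_1 .$$ Then, with probability at least $1-Cp^2\exp(-cns^{-2}\zeta^{-1})$, the following holds for every run of the algorithm with $\lambda\ge8\tilde K$ and $\rho_3\le\frac{\kappa}{4\sqrt2\,\lambda}$: $$\|\beta^k-\beta^*\|\le\frac{4\sqrt s\,\lambda}{\kappa}\qquad\text{for all }k\in\mathbb N,\ k\ge1 .$$ Here $C,c>0$ are universal constants and $\zeta$ is a positive function of $\beta^*$ (not otherwise of $n$ or $p$), $\tau^2$, $\sigma^2$, $\kappa$,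 $\lambda_{\min}(\Sigma_M^\dagger)$, of the constants $c_X$, $c_M$, $\min_{i,j}(\Sigma_M)_{ij}$, $\min_j(\mu_M)_j$ in (A), and of $\hat\epsilon$. -/

import Mathlib

open MeasureTheory ProbabilityTheory
open scoped NNReal Matrix

noncomputable section

namespace CaZnRLS

/-- The Euclidean norm of a vector. -/
def l2norm {p : ℕ} (v : Fin p → ℝ) : ℝ := √(∑ i, v i ^ 2)

/-- The `ℓ₁`-norm of a vector. -/
def l1norm {p : ℕ} (v : Fin p → ℝ) : ℝ := ∑ i, |v i|

/-- The support `S* = {i : βᵢ ≠ 0}` of a vector. -/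
def supp {p : ℕ} (β : Fin p → ℝ) : Finset (Fin p) := Finset.univ.filter (fun i => β i ≠ 0)

/-- The sparsity `s`: the number of nonzero entries of a vector. -/
def sparsity {p : ℕ} (β : Fin p → ℝ) : ℕ := (supp β).card

/-- A vector extended by zeros, so that one function can take vectors of all dimensions
as its argument without seeing the ambient dimension. -/
def zeroExtend {p : ℕ} (β : Fin p → ℝ) : ℕ → ℝ := fun i => if h : i < p then β ⟨i, h⟩ else 0

/-- `λ_min(A)` of a real symmetric matrix: its smallest eigenvalue. -/
def lambdaMin {p : ℕ} (A : Matrix (Fin p) (Fin p) ℝ) : ℝ := sInf (spectrum ℝ A)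

/-! ### The restricted eigenvalue condition -/

/-- The cone
`C(S) = ⋃_{T ⊇ S, |T| ≤ 1.5 |S|} {b : ‖b_{Tᶜ}‖₁ ≤ 3 ‖b_T‖₁}`. -/
def cone {p : ℕ} (S : Finset (Fin p)) : Set (Fin p → ℝ) :=
  {b | ∃ T : Finset (Fin p), S ⊆ T ∧ (T.card : ℝ) ≤ 1.5 * (S.card : ℝ) ∧
    ∑ i ∈ Tᶜ, |b i| ≤ 3 * ∑ i ∈ T, |b i|}

/-- The Gram matrix `n⁻¹ Xᵀ X`. -/
def gram {n p : ℕ} (X : Matrix (Fin n) (Fin p) ℝ) : Matrix (Fin p) (Fin p) ℝ :=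
  (1 / (n : ℝ)) • (Xᵀ * X)

/-- The `κ`-restricted eigenvalue condition of the matrix `A` on the cone `C(S)`. -/
def REC {p : ℕ} (A : Matrix (Fin p) (Fin p) ℝ) (κ : ℝ) (S : Finset (Fin p)) : Prop :=
  0 < κ ∧ ∀ b ∈ cone S, κ * l2norm b ^ 2 ≤ b ⬝ᵥ (A *ᵥ b)

/-! ### The calibrated pair and the multi-stage convex relaxation -/

/-- `Z̃ = √n P Diag(√max(θ₁, ε), …, √max(θ_p, ε)) Pᵀ` where `A = P Diag(θ₁, …, θ_p) Pᵀ` is the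
eigenvalue decomposition of the symmetric matrix `A` (functional calculus of `A`). -/
def calibratedZ {p : ℕ} (n : ℕ) (epsHat : ℝ) (A : Matrix (Fin p) (Fin p) ℝ) :
    Matrix (Fin p) (Fin p) ℝ :=
  √(n : ℝ) • cfc (fun x : ℝ => √(max x epsHat)) A

/-- `ỹ = √n P Diag(1/√max(θ₁, ε), …, 1/√max(θ_p, ε)) Pᵀ ξ` where
`A = P Diag(θ₁, …, θ_p) Pᵀ` is the eigenvalue decomposition of the symmetric matrix `A`. -/
def calibratedY {p : ℕ} (n : ℕ) (epsHat : ℝ) (A : Matrix (Fin p) (Fin p) ℝ)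
    (ξ : Fin p → ℝ) : Fin p → ℝ :=
  (√(n : ℝ) • cfc (fun x : ℝ => 1 / √(max x epsHat)) A) *ᵥ ξ

/-- `φ(t) = (a-1)/(a+1) t² + 2/(a+1) t`. -/
def phi (a t : ℝ) : ℝ := (a - 1) / (a + 1) * t ^ 2 + 2 / (a + 1) * t

/-- The weighted `ℓ₁`-regularized least squares objective
`(2n)⁻¹ ‖Z̃ b - ỹ‖² + lam ∑ᵢ (1 - wᵢ) |bᵢ|`. -/
def stageObjective {p : ℕ} (n : ℕ) (Zt : Matrix (Fin p) (Fin p) ℝ) (yt : Fin p → ℝ)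
    (lam : ℝ) (w b : Fin p → ℝ) : ℝ :=
  1 / (2 * (n : ℝ)) * l2norm (Zt *ᵥ b - yt) ^ 2 + lam * ∑ i, (1 - w i) * |b i|

/-- `(β^k)_{k ≥ 1}`, `(w^k)_{k ≥ 0}`, `(ρ_k)_{k ≥ 0}` are generated by the multi-stage convex
relaxation algorithm (GEP-MSCRA) from the pair `(Z̃, ỹ)` with regularization parameter `lam`
and parameter `a` of `φ`. The entry `β 0` plays no role. -/
structure IsRun {p : ℕ} (n : ℕ) (Zt : Matrix (Fin p) (Fin p) ℝ) (yt : Fin p → ℝ)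
    (a lam : ℝ) (ρ : ℕ → ℝ) (w β : ℕ → Fin p → ℝ) : Prop where
  a_gt_one : 1 < a
  lam_pos : 0 < lam
  rho_zero : ρ 0 = 1
  w_zero : ∀ i, w 0 i ∈ Set.Icc (0 : ℝ) (1 / 2)
  beta_argmin : ∀ k, 1 ≤ k → ∀ b : Fin p → ℝ,
    stageObjective n Zt yt lam (w (k - 1)) (β k) ≤ stageObjective n Zt yt lam (w (k - 1)) b
  rho_mono : ∀ k, 1 ≤ k → k ≤ 3 → ρ (k - 1) ≤ ρ k
  rho_const : ∀ k, 3 < k → ρ k = ρ (k - 1)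
  w_mem : ∀ k, 1 ≤ k → ∀ i, w k i ∈ Set.Icc (0 : ℝ) 1
  w_argmin : ∀ k, 1 ≤ k → ∀ i, ∀ t ∈ Set.Icc (0 : ℝ) 1,
    phi a (w k i) - ρ k * w k i * |β k i| ≤ phi a t - ρ k * t * |β k i|

/-! ### Multiplicative errors -/

/-- The entrywise (Hadamard) product `X ∘ M`. -/
def corrupted {n p : ℕ} (X M : Matrix (Fin n) (Fin p) ℝ) : Matrix (Fin n) (Fin p) ℝ := X ⊙ M

/-- The responses `y = X β* + ε`. -/
def response {n p : ℕ} (X : Matrix (Fin n) (Fin p) ℝ) (βs : Fin p → ℝ) (ε : Fin n → ℝ) :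
    Fin n → ℝ := X *ᵥ βs + ε

/-- The surrogate of the Gram matrix: `n⁻¹ Zᵀ Z` divided entrywise by `Σ_M + μ_M μ_Mᵀ`. -/
def SigmaHatMul {n p : ℕ} (Z : Matrix (Fin n) (Fin p) ℝ) (μM : Fin p → ℝ)
    (SigmaM : Matrix (Fin p) (Fin p) ℝ) : Matrix (Fin p) (Fin p) ℝ :=
  Matrix.of fun j k => gram Z j k / (SigmaM j k + μM j * μM k)

/-- The surrogate of `n⁻¹ Xᵀ y`: the vector `n⁻¹ Zᵀ y` divided entrywise by `μ_M`. -/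
def xiHatMul {n p : ℕ} (Z : Matrix (Fin n) (Fin p) ℝ) (y : Fin n → ℝ) (μM : Fin p → ℝ) :
    Fin p → ℝ :=
  fun j => (1 / (n : ℝ)) * (Zᵀ *ᵥ y) j / μM j

/-- `Σ_M†`: the entrywise reciprocal of `Σ_M + μ_M μ_Mᵀ`. -/
def SigmaDagger {p : ℕ} (μM : Fin p → ℝ) (SigmaM : Matrix (Fin p) (Fin p) ℝ) :
    Matrix (Fin p) (Fin p) ℝ :=
  Matrix.of fun j k => 1 / (SigmaM j k + μM j * μM k)

/-- `K̃ = 2 [ε̂ - min(λ_min(Σ_M†), 0) c_M²] ‖β*‖₁`. -/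
def KTilde {p : ℕ} (epsHat cM : ℝ) (μM : Fin p → ℝ) (SigmaM : Matrix (Fin p) (Fin p) ℝ)
    (βs : Fin p → ℝ) : ℝ :=
  2 * (epsHat - min (lambdaMin (SigmaDagger μM SigmaM)) 0 * cM ^ 2) * l1norm βs

/-- The noise `ε₁, …, ε_n` is i.i.d. and sub-Gaussian with parameter `σ²`:
`E exp(t εᵢ) ≤ exp(σ² t² / 2)` for all `t`. -/
structure IsSubGaussianNoise {n : ℕ} {Ω : Type*} [MeasurableSpace Ω] (P : Measure Ω)
    (ε : Ω → Fin n → ℝ) (σ : ℝ≥0) : Prop where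
  measurable : ∀ i, Measurable fun ω => ε ω i
  indep : iIndepFun (fun i ω => ε ω i) P
  identDistrib : ∀ i i', IdentDistrib (fun ω => ε ω i) (fun ω => ε ω i') P P
  subGaussian : ∀ i, HasSubgaussianMGF (fun ω => ε ω i) (σ ^ 2) P

/-- The rows of `M` are i.i.d. with mean `μM`, covariance matrix `SigmaM` and sub-Gaussian
parameter `τ²` (every one-dimensional projection along a unit vector, once centered, is
sub-Gaussian with parameter `τ²`). -/
structure IsErrorMatrix {n p : ℕ} {Ω : Type*} [MeasurableSpace Ω] (P : Measure Ω)
    (M : Ω → Matrix (Fin n) (Fin p) ℝ) (μM : Fin p → ℝ) (SigmaM : Matrix (Fin p) (Fin p) ℝ)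
    (τ : ℝ≥0) : Prop where
  measurable : ∀ i, Measurable fun ω => (fun j => M ω i j : Fin p → ℝ)
  indep : iIndepFun (fun i ω => (fun j => M ω i j : Fin p → ℝ)) P
  identDistrib : ∀ i i', IdentDistrib (fun ω => (fun j => M ω i j : Fin p → ℝ))
    (fun ω => (fun j => M ω i' j : Fin p → ℝ)) P P
  mean : ∀ i j, ∫ ω, M ω i j ∂P = μM j
  cov : ∀ i j k, covariance (fun ω => M ω i j) (fun ω => M ω i k) P = SigmaM j k
  subGaussian : ∀ i, ∀ v : Fin p → ℝ, ∑ j, v j ^ 2 = 1 →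
    HasSubgaussianMGF (fun ω => ∑ j, v j * (M ω i j - μM j)) (τ ^ 2) P

end CaZnRLS

end

noncomputable section

namespace CaZnRLS

/-! ### Quadratic forms and the functional calculus -/

/-! The argument splits into a deterministic part and a union bound. With `G = n⁻¹ Z̃ᵀZ̃`, which is
`Σ̂` with its eigenvalues clipped from below at `ε̂`, every stage is a weighted Lasso that sees the
data only through `G` and `ξ̂`. It succeeds if `‖ξ̂ - Gβ*‖_∞ ≤ λ/8` and if `G` satisfies the
restricted eigenvalue condition with `κ/2`.

For the eigenvalue condition, `‖b‖₁² ≤ 24 s ‖b‖²` on the cone, so an entrywise error `κ/(48s)` in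
`Σ̂` costs at most half of `κ`, and clipping only raises the quadratic form (`REC_perturbation`,
`quadratic_le_calibratedGram`). For the residual, the clipping error `(G - Σ̂)β*` does not vanish
with `n`. Since `Σ̂` is the Schur product of a Gram matrix with `Σ_M†`, its spectrum is bounded
below by `min(λ_min(Σ_M†), 0) c_M²`, so the clipping error is at most `K̃/2` in each coordinate. The
random errors of `Σ̂`, of the signal part of `ξ̂` and of the noise add at most `ε̂‖β*‖₁ ≤ K̃/2`,
whence `λ ≥ 8K̃`.

Passing from stage to stage (`IsRun.error_bound`), an off-support weight above `1/2` forces `|β_i^k|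
≥ 1/ρ_k`. The current error bound and the condition on `ρ_3` allow at most `s/2` such indices, so
the enlarged support still has at most `1.5s` elements and the same error bound recurs
(`stage_error_bound`).

The random errors are averages over independent rows, controlled by Hoeffding's inequality and,
conditionally on `M`, by the sub-Gaussian noise. -/

open scoped MatrixOrder in
theorem cfc_quadratic_mono {p : ℕ} {A : Matrix (Fin p) (Fin p) ℝ} {f g : ℝ → ℝ}
    (hfc : Continuous f) (hgc : Continuous g) (hfg : ∀ x ∈ spectrum ℝ A, f x ≤ g x)
    (v : Fin p → ℝ) : v ⬝ᵥ (cfc f A *ᵥ v) ≤ v ⬝ᵥ (cfc g A *ᵥ v) := by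
  have h : cfc f A ≤ cfc g A := cfc_mono hfg hfc.continuousOn hgc.continuousOn
  have h1 := (Matrix.le_iff.mp h).dotProduct_mulVec_nonneg v
  simpa [Matrix.sub_mulVec, dotProduct_sub] using h1

theorem bddBelow_spectrum {p : ℕ} (A : Matrix (Fin p) (Fin p) ℝ) :
    BddBelow (spectrum ℝ A) := (Matrix.finite_real_spectrum (A := A)).bddBelow

theorem lambdaMin_mul_le_quadratic {p : ℕ} {A : Matrix (Fin p) (Fin p) ℝ} (hA : A.IsHermitian)
    (v : Fin p → ℝ) : lambdaMin A * (v ⬝ᵥ v) ≤ v ⬝ᵥ (A *ᵥ v) := by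
  have hA' : IsSelfAdjoint A := hA
  have h := cfc_quadratic_mono (A := A) (f := fun _ => lambdaMin A) (g := fun x => x)
    continuous_const continuous_id (fun x hx => csInf_le (bddBelow_spectrum A) hx) v
  rw [cfc_const _ A, cfc_id' ℝ A, Algebra.algebraMap_eq_smul_one, Matrix.smul_mulVec,
    Matrix.one_mulVec, dotProduct_smul, smul_eq_mul] at h
  exact h

theorem le_of_mem_spectrum {p : ℕ} {A : Matrix (Fin p) (Fin p) ℝ} (hA : A.IsHermitian) {m x : ℝ}
    (h : ∀ v : Fin p → ℝ, m * (v ⬝ᵥ v) ≤ v ⬝ᵥ (A *ᵥ v)) (hx : x ∈ spectrum ℝ A) : m ≤ x := by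
  obtain ⟨i, rfl⟩ := hA.spectrum_real_eq_range_eigenvalues ▸ hx
  set v : Fin p → ℝ := ⇑(hA.eigenvectorBasis i) with hv
  have h1 := h v
  have h2 : A *ᵥ v = hA.eigenvalues i • v := hA.mulVec_eigenvectorBasis i
  rw [h2, dotProduct_smul, smul_eq_mul] at h1
  have h3 : 0 < v ⬝ᵥ v := by
    refine lt_of_le_of_ne (by simpa using dotProduct_star_self_nonneg v) (Ne.symm ?_)
    intro h0
    have : v = 0 := dotProduct_self_eq_zero.mp h0
    exact hA.eigenvectorBasis.orthonormal.ne_zero i (by ext j; exact congrFun this j)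
  exact le_of_mul_le_mul_right h1 h3

/-- The calibrated surrogate `n⁻¹ Z̃ᵀ Z̃ = P Diag(max(θ, ε)) Pᵀ`. -/
def calibratedGram {p : ℕ} (epsHat : ℝ) (A : Matrix (Fin p) (Fin p) ℝ) :
    Matrix (Fin p) (Fin p) ℝ := cfc (fun x : ℝ => max x epsHat) A

theorem transpose_cfc {p : ℕ} (f : ℝ → ℝ) (A : Matrix (Fin p) (Fin p) ℝ) :
    (cfc f A)ᵀ = cfc f A := by
  have h : IsSelfAdjoint (cfc f A) := cfc_predicate f A
  simpa [IsSelfAdjoint, Matrix.star_eq_conjTranspose] using h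

theorem continuous_one_div_sqrt_max {e : ℝ} (he : 0 < e) :
    Continuous fun x : ℝ => 1 / √(max x e) := by
  refine continuous_const.div (by fun_prop) fun x => ?_
  exact (Real.sqrt_pos.mpr (lt_of_lt_of_le he (le_max_right _ _))).ne'

/-- This and the companion identity for `Z̃ᵀỹ` eliminate `Z̃` and `ỹ`: up to an additive constant
the least squares term depends only on the clipped matrix and on `ξ`. -/
theorem calibratedZ_gram {p n : ℕ} {e : ℝ} (he : 0 < e) (A : Matrix (Fin p) (Fin p) ℝ) :
    (calibratedZ n e A)ᵀ * calibratedZ n e A = (n : ℝ) • calibratedGram e A := by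
  unfold calibratedZ calibratedGram
  rw [Matrix.transpose_smul, transpose_cfc, Matrix.smul_mul, Matrix.mul_smul, smul_smul,
    Real.mul_self_sqrt (Nat.cast_nonneg n),
    ← cfc_mul _ _ A (by fun_prop) (by fun_prop)]
  congr 2
  ext x
  exact Real.mul_self_sqrt (he.le.trans (le_max_right _ _))

theorem calibratedZ_mulVec_calibratedY {p n : ℕ} {e : ℝ} (he : 0 < e)
    {A : Matrix (Fin p) (Fin p) ℝ} (hA : A.IsHermitian) (ξ : Fin p → ℝ) :
    (calibratedZ n e A)ᵀ *ᵥ calibratedY n e A ξ = (n : ℝ) • ξ := by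
  have hA' : IsSelfAdjoint A := hA
  unfold calibratedZ calibratedY
  rw [Matrix.mulVec_mulVec, Matrix.transpose_smul, transpose_cfc, Matrix.smul_mul,
    Matrix.mul_smul, smul_smul, Real.mul_self_sqrt (Nat.cast_nonneg n),
    ← cfc_mul _ _ A (by fun_prop) (continuous_one_div_sqrt_max he).continuousOn]
  have h : (fun x : ℝ => √(max x e) * (1 / √(max x e))) = fun _ => 1 := by
    ext x
    have := (Real.sqrt_pos.mpr (lt_of_lt_of_le he (le_max_right x e))).ne'
    field_simp
  rw [h, cfc_const_one ℝ A, Matrix.smul_mulVec, Matrix.one_mulVec]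

theorem quadratic_le_calibratedGram {p : ℕ} {e : ℝ} {A : Matrix (Fin p) (Fin p) ℝ}
    (hA : A.IsHermitian) (v : Fin p → ℝ) :
    v ⬝ᵥ (A *ᵥ v) ≤ v ⬝ᵥ (calibratedGram e A *ᵥ v) := by
  have hA' : IsSelfAdjoint A := hA
  have h := cfc_quadratic_mono (A := A) (f := fun x => x) (g := fun x => max x e)
    continuous_id (by fun_prop) (fun x _ => le_max_left _ _) v
  rwa [cfc_id' ℝ A] at h

/-- Clipping at `e` moves an eigenvalue `x ≥ m` up by at most `e - m`; when `x ≥ e` it does not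
move, and `e - m ≥ 0` is what is needed. -/
theorem calibratedGram_quadratic_le {p : ℕ} {e m : ℝ} (hm : m ≤ 0) (he : 0 < e)
    {A : Matrix (Fin p) (Fin p) ℝ}
    (hA : A.IsHermitian) (hs : ∀ x ∈ spectrum ℝ A, m ≤ x) (v : Fin p → ℝ) :
    v ⬝ᵥ (calibratedGram e A *ᵥ v) ≤ v ⬝ᵥ (A *ᵥ v) + (e - m) * (v ⬝ᵥ v) := by
  have hA' : IsSelfAdjoint A := hA
  have h := cfc_quadratic_mono (A := A) (f := fun x => max x e) (g := fun x => x + (e - m))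
    (by fun_prop) (by fun_prop) (fun x hx => ?_) v
  · rw [cfc_add_const _ _ A (by fun_prop), cfc_id' ℝ A, Algebra.algebraMap_eq_smul_one,
      Matrix.add_mulVec, Matrix.smul_mulVec,
      Matrix.one_mulVec, dotProduct_add, dotProduct_smul, smul_eq_mul] at h
    exact h
  · have := hs x hx
    exact max_le (by linarith) (by linarith)

/-- A matrix between `0` and `L` in the positive semidefinite order has entries at most `L`. -/
theorem abs_entry_le {p : ℕ} {D : Matrix (Fin p) (Fin p) ℝ} (hD : Dᵀ = D) {L : ℝ}
    (h0 : ∀ v, 0 ≤ v ⬝ᵥ (D *ᵥ v)) (hL : ∀ v, v ⬝ᵥ (D *ᵥ v) ≤ L * (v ⬝ᵥ v)) (j k : Fin p) :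
    |D j k| ≤ L := by
  have hs : D k j = D j k := congrFun (congrFun hD j) k
  have key : ∀ i, D i i ≤ L := fun i => by
    have := hL (Pi.single i 1)
    simpa using this
  -- Testing on `e_j ± e_k` gives `|D j k| ≤ (D j j + D k k) / 2`.
  have h1 := h0 (Pi.single j 1 + Pi.single k 1)
  have h2 := h0 (Pi.single j 1 - Pi.single k 1)
  simp only [Matrix.mulVec_add, Matrix.mulVec_sub, add_dotProduct, sub_dotProduct,
    dotProduct_add, dotProduct_sub, Matrix.mulVec_single_one, single_dotProduct, one_mul,
    Matrix.col_apply, hs] at h1 h2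
  have := key j
  have := key k
  rw [abs_le]
  constructor <;> linarith

/-- The identity behind Schur's product theorem: each row of `Z` contributes the form of `B` at `v`
rescaled by that row, so a spectral bound for `B` transfers. -/
theorem quadratic_hadamard_gram {n p : ℕ} (Z : Matrix (Fin n) (Fin p) ℝ)
    (B : Matrix (Fin p) (Fin p) ℝ) (v : Fin p → ℝ) :
    v ⬝ᵥ ((gram Z ⊙ B) *ᵥ v) =
      1 / (n : ℝ) * ∑ i, (fun j => Z i j * v j) ⬝ᵥ (B *ᵥ fun j => Z i j * v j) := by
  simp only [gram, dotProduct, Matrix.mulVec, Matrix.hadamard_apply, Matrix.smul_apply,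
    Matrix.mul_apply, Matrix.transpose_apply, smul_eq_mul, Finset.mul_sum, Finset.sum_mul]
  rw [Finset.sum_comm_cycle]
  refine Finset.sum_congr rfl fun i _ => Finset.sum_congr rfl fun j _ =>
    Finset.sum_congr rfl fun k _ => ?_
  ring

/-- A lower bound for the quadratic form of a Schur product with a Gram matrix. -/
theorem quadratic_hadamard_gram_ge {n p : ℕ} {Z : Matrix (Fin n) (Fin p) ℝ}
    {B : Matrix (Fin p) (Fin p) ℝ} (hB : B.IsHermitian) {d : ℝ} (hd : ∀ j, gram Z j j ≤ d)
    (v : Fin p → ℝ) :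
    min (lambdaMin B) 0 * d * (v ⬝ᵥ v) ≤ v ⬝ᵥ ((gram Z ⊙ B) *ᵥ v) := by
  rw [quadratic_hadamard_gram]
  set m := min (lambdaMin B) 0 with hm
  have hm0 : m ≤ 0 := min_le_right _ _
  have h1 : ∀ i, m * ((fun j => Z i j * v j) ⬝ᵥ fun j => Z i j * v j) ≤
      (fun j => Z i j * v j) ⬝ᵥ (B *ᵥ fun j => Z i j * v j) := fun i =>
    (mul_le_mul_of_nonneg_right (min_le_left _ _)
      (by simpa using dotProduct_star_self_nonneg fun j => Z i j * v j)).trans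
      (lambdaMin_mul_le_quadratic hB _)
  have h2 : 1 / (n : ℝ) * ∑ i, m * ((fun j => Z i j * v j) ⬝ᵥ fun j => Z i j * v j) =
      m * ∑ j, gram Z j j * (v j * v j) := by
    simp only [gram, dotProduct, Matrix.smul_apply, Matrix.mul_apply, Matrix.transpose_apply,
      smul_eq_mul, Finset.mul_sum, Finset.sum_mul]
    rw [Finset.sum_comm]
    refine Finset.sum_congr rfl fun i _ => Finset.sum_congr rfl fun j _ => ?_
    ring
  calc m * d * (v ⬝ᵥ v) = m * ∑ j, d * (v j * v j) := by
        rw [mul_assoc, dotProduct, Finset.mul_sum]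
    _ ≤ m * ∑ j, gram Z j j * (v j * v j) :=
        mul_le_mul_of_nonpos_left (Finset.sum_le_sum fun j _ =>
          mul_le_mul_of_nonneg_right (hd j) (mul_self_nonneg _)) hm0
    _ = _ := h2.symm
    _ ≤ _ := mul_le_mul_of_nonneg_left (Finset.sum_le_sum fun i _ => h1 i) (by positivity)

theorem abs_mulVec_le {p : ℕ} {D : Matrix (Fin p) (Fin p) ℝ} {L : ℝ} (h : ∀ j k, |D j k| ≤ L)
    (v : Fin p → ℝ) (j : Fin p) : |(D *ᵥ v) j| ≤ L * l1norm v := by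
  rw [l1norm, Finset.mul_sum, Matrix.mulVec, dotProduct]
  refine (Finset.abs_sum_le_sum_abs _ _).trans (Finset.sum_le_sum fun k _ => ?_)
  rw [abs_mul]
  exact mul_le_mul_of_nonneg_right (h j k) (abs_nonneg _)

theorem abs_quadratic_le {p : ℕ} {D : Matrix (Fin p) (Fin p) ℝ} {L : ℝ} (h : ∀ j k, |D j k| ≤ L)
    (v : Fin p → ℝ) : |v ⬝ᵥ (D *ᵥ v)| ≤ L * l1norm v ^ 2 := by
  have : L * l1norm v ^ 2 = ∑ j, |v j| * (L * l1norm v) := by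
    rw [← Finset.sum_mul, ← l1norm]; ring
  rw [this, dotProduct]
  refine (Finset.abs_sum_le_sum_abs _ _).trans (Finset.sum_le_sum fun j _ => ?_)
  rw [abs_mul]
  exact mul_le_mul_of_nonneg_left (abs_mulVec_le h v j) (abs_nonneg _)

/-! ### Restricted eigenvalues on the cone -/

theorem l2norm_sq {p : ℕ} (v : Fin p → ℝ) : l2norm v ^ 2 = ∑ i, v i ^ 2 :=
  Real.sq_sqrt (Finset.sum_nonneg fun _ _ => sq_nonneg _)

theorem l2norm_sq_eq_dotProduct {p : ℕ} (v : Fin p → ℝ) : l2norm v ^ 2 = v ⬝ᵥ v := by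
  rw [l2norm_sq]
  exact Finset.sum_congr rfl fun i _ => sq (v i)

theorem l2norm_nonneg {p : ℕ} (v : Fin p → ℝ) : 0 ≤ l2norm v := Real.sqrt_nonneg _

theorem sum_abs_sq_le {p : ℕ} (T : Finset (Fin p)) (v : Fin p → ℝ) :
    (∑ i ∈ T, |v i|) ^ 2 ≤ T.card * l2norm v ^ 2 := by
  refine sq_sum_le_card_mul_sum_sq.trans ?_
  rw [l2norm_sq]
  refine mul_le_mul_of_nonneg_left ?_ (Nat.cast_nonneg _)
  simp only [sq_abs]
  exact Finset.sum_le_sum_of_subset_of_nonneg (Finset.subset_univ _) fun i _ _ => sq_nonneg _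

/-- The constant is `24 = 4² · 1.5`: the cone gives `‖b‖₁ ≤ 4‖b_T‖₁`, and Cauchy–Schwarz on `T`
costs `|T| ≤ 1.5|S|`. -/
theorem l1norm_sq_le_of_mem_cone {p : ℕ} {S : Finset (Fin p)} {b : Fin p → ℝ} (hb : b ∈ cone S) :
    l1norm b ^ 2 ≤ 24 * S.card * l2norm b ^ 2 := by
  obtain ⟨T, _, hc, h⟩ := hb
  have h1 : l1norm b ≤ 4 * ∑ i ∈ T, |b i| := by
    rw [l1norm, ← Finset.sum_add_sum_compl T]
    linarith
  have h0 : 0 ≤ l1norm b := Finset.sum_nonneg fun i _ => abs_nonneg _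
  have h2 := sum_abs_sq_le T b
  have h3 : (T.card : ℝ) * l2norm b ^ 2 ≤ 1.5 * S.card * l2norm b ^ 2 :=
    mul_le_mul_of_nonneg_right hc (sq_nonneg _)
  nlinarith [pow_le_pow_left₀ h0 h1 2]

/-- The restricted eigenvalue condition survives small entrywise perturbations. -/
theorem REC_perturbation {p : ℕ} {A B : Matrix (Fin p) (Fin p) ℝ} {κ : ℝ} {S : Finset (Fin p)}
    (hA : REC A κ S) (hS : S.Nonempty) (hAB : ∀ j k, |(B - A) j k| ≤ κ / (48 * S.card)) :
    ∀ b ∈ cone S, κ / 2 * l2norm b ^ 2 ≤ b ⬝ᵥ (B *ᵥ b) := by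
  intro b hb
  have h1 := hA.2 b hb
  have h2 := (abs_le.mp (abs_quadratic_le hAB b)).1
  have hc : (0 : ℝ) < S.card := by exact_mod_cast hS.card_pos
  have h3 : κ / (48 * S.card) * l1norm b ^ 2 ≤ κ / 2 * l2norm b ^ 2 := by
    have hκ := hA.1
    calc κ / (48 * S.card) * l1norm b ^ 2
        ≤ κ / (48 * S.card) * (24 * S.card * l2norm b ^ 2) :=
          mul_le_mul_of_nonneg_left (l1norm_sq_le_of_mem_cone hb) (by positivity)
      _ = κ / 2 * l2norm b ^ 2 := by field_simp; ring
  rw [Matrix.sub_mulVec, dotProduct_sub] at h2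
  linarith

/-! ### One stage of the algorithm -/

theorem nonpos_of_forall_le_mul {a b : ℝ} (hb : 0 ≤ b)
    (h : ∀ t : ℝ, 0 < t → t ≤ 1 → a ≤ t * b) : a ≤ 0 := by
  by_contra! ha
  have h1 := h (a / (a + b)) (by positivity) (by rw [div_le_one (by positivity)]; linarith)
  rw [div_mul_eq_mul_div, le_div_iff₀ (by positivity)] at h1
  nlinarith

/-- The variational inequality satisfied by a minimizer of the stage objective. -/
theorem stage_variational {p n : ℕ} (hn : 0 < n) {Zt G : Matrix (Fin p) (Fin p) ℝ}
    {yt ξ w b bs : Fin p → ℝ} {lam : ℝ} (hlam : 0 < lam)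
    (hG : Ztᵀ * Zt = (n : ℝ) • G) (hξ : Ztᵀ *ᵥ yt = (n : ℝ) • ξ) (hw : ∀ i, w i ≤ 1)
    (hmin : ∀ b', stageObjective n Zt yt lam w b ≤ stageObjective n Zt yt lam w b') :
    (b - bs) ⬝ᵥ (G *ᵥ (b - bs)) ≤
      (ξ - G *ᵥ bs) ⬝ᵥ (b - bs) + lam * ∑ i, (1 - w i) * (|bs i| - |b i|) := by
  have hn' : (0 : ℝ) < n := by exact_mod_cast hn
  set Δ := b - bs with hΔ
  have hquad : Δ ⬝ᵥ (G *ᵥ Δ) - (ξ - G *ᵥ bs) ⬝ᵥ Δ =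
      1 / (n : ℝ) * ((Zt *ᵥ b - yt) ⬝ᵥ (Zt *ᵥ Δ)) := by
    have e1 : (Zt *ᵥ b - yt) ⬝ᵥ (Zt *ᵥ Δ) = (n : ℝ) * ((G *ᵥ b - ξ) ⬝ᵥ Δ) := by
      rw [Matrix.dotProduct_mulVec, ← Matrix.mulVec_transpose, Matrix.mulVec_sub,
        Matrix.mulVec_mulVec, hG, hξ, Matrix.smul_mulVec, ← smul_sub, smul_dotProduct,
        smul_eq_mul]
    rw [e1, one_div, inv_mul_cancel_left₀ hn'.ne', dotProduct_comm Δ, ← sub_dotProduct,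
      hΔ, Matrix.mulVec_sub]
    congr 1
    abel
  suffices h : 1 / (n : ℝ) * ((Zt *ᵥ b - yt) ⬝ᵥ (Zt *ᵥ Δ)) -
      lam * ∑ i, (1 - w i) * (|bs i| - |b i|) ≤ 0 by linarith
  -- First-order optimality without subgradients: compare `b` with `b - tΔ` on the segment towards
  -- `bs`, bound the penalty by convexity, divide by `t` and let `t → 0`.
  refine nonpos_of_forall_le_mul (b := 1 / (2 * (n : ℝ)) * ((Zt *ᵥ Δ) ⬝ᵥ (Zt *ᵥ Δ)))
    (mul_nonneg (by positivity) ?_) fun t ht ht1 => ?_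
  · rw [← l2norm_sq_eq_dotProduct]; positivity
  have h1 := hmin (b - t • Δ)
  have h2 : Zt *ᵥ (b - t • Δ) - yt = (Zt *ᵥ b - yt) - t • (Zt *ᵥ Δ) := by
    rw [Matrix.mulVec_sub, Matrix.mulVec_smul]; abel
  have h3 : ∑ i, (1 - w i) * |(b - t • Δ) i| ≤
      ∑ i, (1 - w i) * |b i| + t * ∑ i, (1 - w i) * (|bs i| - |b i|) := by
    rw [Finset.mul_sum, ← Finset.sum_add_distrib]
    refine Finset.sum_le_sum fun i _ => ?_
    have h4 : |(b - t • Δ) i| ≤ (1 - t) * |b i| + t * |bs i| := by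
      have : (b - t • Δ) i = (1 - t) * b i + t * bs i := by
        simp only [hΔ, Pi.sub_apply, Pi.smul_apply, smul_eq_mul]; ring
      rw [this]
      refine (abs_add_le _ _).trans ?_
      rw [abs_mul, abs_mul, abs_of_nonneg ht.le, abs_of_nonneg (sub_nonneg.mpr ht1)]
    have := mul_le_mul_of_nonneg_left h4 (sub_nonneg.mpr (hw i))
    linarith
  unfold stageObjective at h1
  rw [h2, l2norm_sq_eq_dotProduct, l2norm_sq_eq_dotProduct] at h1
  generalize Zt *ᵥ b - yt = r at *
  generalize Zt *ᵥ Δ = q at *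
  have h5 : (r - t • q) ⬝ᵥ (r - t • q) = r ⬝ᵥ r - 2 * t * (r ⬝ᵥ q) + t ^ 2 * (q ⬝ᵥ q) := by
    simp only [sub_dotProduct, dotProduct_sub, smul_dotProduct, dotProduct_smul, smul_eq_mul,
      dotProduct_comm q r]
    ring
  rw [h5] at h1
  have h6 := mul_le_mul_of_nonneg_left h3 hlam.le
  have h7 : t * (1 / (n : ℝ) * (r ⬝ᵥ q) - lam * ∑ i, (1 - w i) * (|bs i| - |b i|)) ≤
      t * (t * (1 / (2 * (n : ℝ)) * (q ⬝ᵥ q))) := by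
    have e : 1 / (2 * (n : ℝ)) * (r ⬝ᵥ r - 2 * t * (r ⬝ᵥ q) + t ^ 2 * (q ⬝ᵥ q)) =
        1 / (2 * (n : ℝ)) * (r ⬝ᵥ r) - t * (1 / (n : ℝ) * (r ⬝ᵥ q)) +
          t * (t * (1 / (2 * (n : ℝ)) * (q ⬝ᵥ q))) := by
      field_simp
    linarith
  exact le_of_mul_le_mul_left h7 ht

/-- The error bound for one stage, provided that the weights exceeding `1/2` lie on a small
set containing the support. -/
theorem stage_error_bound {p n : ℕ} (hn : 0 < n) {Zt G : Matrix (Fin p) (Fin p) ℝ}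
    {yt ξ w b bs : Fin p → ℝ} {lam κ : ℝ} (hlam : 0 < lam) (hκ : 0 < κ)
    (hG : Ztᵀ * Zt = (n : ℝ) • G) (hξ : Ztᵀ *ᵥ yt = (n : ℝ) • ξ)
    (hw : ∀ i, w i ∈ Set.Icc (0 : ℝ) 1)
    (hmin : ∀ b', stageObjective n Zt yt lam w b ≤ stageObjective n Zt yt lam w b')
    (hres : ∀ i, |(ξ - G *ᵥ bs) i| ≤ lam / 8)
    (hREC : ∀ v ∈ cone (supp bs), κ / 2 * l2norm v ^ 2 ≤ v ⬝ᵥ (G *ᵥ v))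
    (hG0 : ∀ v, 0 ≤ v ⬝ᵥ (G *ᵥ v))
    {T : Finset (Fin p)} (hT : supp bs ⊆ T) (hTc : (T.card : ℝ) ≤ 1.5 * (supp bs).card)
    (hwT : ∀ i ∉ T, w i ≤ 1 / 2) :
    l2norm (b - bs) ≤ 4 * √(sparsity bs : ℝ) * lam / κ := by
  have hvar := stage_variational hn (bs := bs) hlam hG hξ (fun i => (hw i).2) hmin
  set Δ := b - bs with hΔ
  -- On `T` the coefficient is `1/8 + 1`; off `T`, where `bs` vanishes and `1 - w ≥ 1/2`, it is `1/8
  -- - 1/2`. Their ratio is the constant `3` of the cone.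
  have hterm : ∀ i, (ξ - G *ᵥ bs) i * Δ i + lam * ((1 - w i) * (|bs i| - |b i|)) ≤
      if i ∈ T then 9 / 8 * lam * |Δ i| else -(3 / 8 * lam * |Δ i|) := by
    intro i
    have h1 : (ξ - G *ᵥ bs) i * Δ i ≤ lam / 8 * |Δ i| := by
      refine (le_abs_self _).trans ?_
      rw [abs_mul]
      exact mul_le_mul_of_nonneg_right (hres i) (abs_nonneg _)
    have h2 := (hw i).1
    have h3 := (hw i).2
    split_ifs with hi
    · have h4 : |bs i| - |b i| ≤ |Δ i| := by
        rw [hΔ, Pi.sub_apply, abs_sub_comm]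
        exact abs_sub_abs_le_abs_sub _ _
      have h5 : (1 - w i) * (|bs i| - |b i|) ≤ |Δ i| :=
        (mul_le_mul_of_nonneg_left h4 (by linarith)).trans
          (mul_le_of_le_one_left (abs_nonneg _) (by linarith))
      nlinarith
    · have hbs : bs i = 0 := by
        by_contra h
        exact hi (hT (by simp [supp, h]))
      have h4 := hwT i hi
      have h5 : Δ i = b i := by simp [hΔ, hbs]
      rw [h5] at h1 ⊢
      rw [hbs, abs_zero, zero_sub]
      have h6 : 1 / 2 * |b i| ≤ (1 - w i) * |b i| :=
        mul_le_mul_of_nonneg_right (by linarith) (abs_nonneg _)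
      nlinarith
  have hsum : Δ ⬝ᵥ (G *ᵥ Δ) ≤
      9 / 8 * lam * ∑ i ∈ T, |Δ i| - 3 / 8 * lam * ∑ i ∈ Tᶜ, |Δ i| := by
    refine hvar.trans ?_
    rw [Finset.mul_sum, dotProduct, ← Finset.sum_add_distrib]
    refine (Finset.sum_le_sum fun i _ => hterm i).trans (le_of_eq ?_)
    rw [← Finset.sum_add_sum_compl T, Finset.mul_sum, Finset.mul_sum, sub_eq_add_neg,
      ← Finset.sum_neg_distrib]
    congr 1
    · exact Finset.sum_congr rfl fun i hi => if_pos hi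
    · exact Finset.sum_congr rfl fun i hi => if_neg (Finset.mem_compl.mp hi)
  have hcone : Δ ∈ cone (supp bs) := by
    refine ⟨T, hT, hTc, ?_⟩
    have h := (hG0 Δ).trans hsum
    have h' : lam * ∑ i ∈ Tᶜ, |Δ i| ≤ lam * (3 * ∑ i ∈ T, |Δ i|) := by linarith
    exact le_of_mul_le_mul_left h' hlam
  have h1 := hREC Δ hcone
  have h2 : 0 ≤ ∑ i ∈ Tᶜ, |Δ i| := Finset.sum_nonneg fun i _ => abs_nonneg _
  have h3 : κ / 2 * l2norm Δ ^ 2 ≤ 9 / 8 * lam * ∑ i ∈ T, |Δ i| := by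
    have : 0 ≤ 3 / 8 * lam * ∑ i ∈ Tᶜ, |Δ i| := by positivity
    linarith
  have hs0 : (0 : ℝ) ≤ sparsity bs := Nat.cast_nonneg _
  -- Cauchy–Schwarz would give `√1.5`; the larger `16/9` makes `9/8 · 16/9 = 2`, hence the factor
  -- `4` after division by `κ/2`.
  have h4 : ∑ i ∈ T, |Δ i| ≤ 16 / 9 * √(sparsity bs : ℝ) * l2norm Δ := by
    refine abs_le_of_sq_le_sq' ?_ (by have := l2norm_nonneg Δ; positivity) |>.2
    rw [mul_pow, mul_pow, Real.sq_sqrt hs0]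
    refine (sum_abs_sq_le T Δ).trans ?_
    refine mul_le_mul_of_nonneg_right ?_ (sq_nonneg _)
    change _ ≤ _ * ((supp bs).card : ℝ)
    change (0 : ℝ) ≤ ((supp bs).card : ℝ) at hs0
    linarith
  rw [le_div_iff₀ hκ]
  rcases (l2norm_nonneg Δ).eq_or_lt with h0 | h0
  · rw [← h0, zero_mul]; positivity
  · have h5 : κ / 2 * l2norm Δ ^ 2 ≤ 9 / 8 * lam * (16 / 9 * √(sparsity bs : ℝ) * l2norm Δ) :=
      h3.trans (mul_le_mul_of_nonneg_left h4 (by positivity))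
    nlinarith

/-! ### All stages -/

/-- A weight above `1/2` can only come from an entry of size at least `1/ρ`. -/
theorem one_le_of_half_lt_weight {a ρ x w : ℝ} (ha : 1 < a) (hw1 : 1 / 2 < w)
    (hmin : phi a w - ρ * w * x ≤ phi a (1 / 2) - ρ * (1 / 2) * x) : 1 ≤ ρ * x := by
  -- `φ` is convex with `φ'(1/2) = 1` for every `a`, so its increment from `1/2` to `w` is at least
  -- `w - 1/2`.
  have h1 : phi a w - phi a (1 / 2) =
      (w - 1 / 2) * ((a - 1) / (a + 1) * (w - 1 / 2) + 1) := by
    unfold phi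
    field_simp
    ring
  have h2 : 0 ≤ (a - 1) / (a + 1) * (w - 1 / 2) :=
    mul_nonneg (div_nonneg (by linarith) (by linarith)) (by linarith)
  have h3 : (w - 1 / 2) * ((a - 1) / (a + 1) * (w - 1 / 2) + 1) ≤ (w - 1 / 2) * (ρ * x) := by
    rw [← h1]; linarith
  have := le_of_mul_le_mul_left h3 (by linarith)
  linarith

theorem IsRun.rho_le {p n : ℕ} {Zt : Matrix (Fin p) (Fin p) ℝ} {yt : Fin p → ℝ} {a lam : ℝ}
    {ρ : ℕ → ℝ} {w β : ℕ → Fin p → ℝ} (h : IsRun n Zt yt a lam ρ w β) (k : ℕ) :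
    0 < ρ k ∧ ρ k ≤ ρ 3 := by
  have h0 := h.rho_zero
  have h1 : ρ 0 ≤ ρ 1 := h.rho_mono 1 le_rfl (by norm_num)
  have h2 : ρ 1 ≤ ρ 2 := h.rho_mono 2 (by norm_num) (by norm_num)
  have h3 : ρ 2 ≤ ρ 3 := h.rho_mono 3 (by norm_num) le_rfl
  have hc : ∀ m, ρ (m + 3) = ρ 3 := fun m => by
    induction m with
    | zero => rfl
    | succ m ih =>
      rw [h.rho_const (m + 1 + 3) (by omega)]
      exact ih
  match k with
  | 0 => exact ⟨by linarith, by linarith⟩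
  | 1 => exact ⟨by linarith, by linarith⟩
  | 2 => exact ⟨by linarith, by linarith⟩
  | m + 3 => rw [hc m]; exact ⟨by linarith, le_rfl⟩

theorem IsRun.error_bound {p n : ℕ} (hn : 0 < n) {Zt G : Matrix (Fin p) (Fin p) ℝ}
    {yt ξ bs : Fin p → ℝ} {a lam κ : ℝ} {ρ : ℕ → ℝ} {w β : ℕ → Fin p → ℝ}
    (hrun : IsRun n Zt yt a lam ρ w β) (hκ : 0 < κ)
    (hG : Ztᵀ * Zt = (n : ℝ) • G) (hξ : Ztᵀ *ᵥ yt = (n : ℝ) • ξ)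
    (hres : ∀ i, |(ξ - G *ᵥ bs) i| ≤ lam / 8)
    (hREC : ∀ v ∈ cone (supp bs), κ / 2 * l2norm v ^ 2 ≤ v ⬝ᵥ (G *ᵥ v))
    (hG0 : ∀ v, 0 ≤ v ⬝ᵥ (G *ᵥ v))
    (hρ : ρ 3 ≤ κ / (4 * √2 * lam)) :
    ∀ k, 1 ≤ k → l2norm (β k - bs) ≤ 4 * √(sparsity bs : ℝ) * lam / κ := by
  have hlam := hrun.lam_pos
  intro k hk
  induction k, hk using Nat.le_induction with
  | base =>
    refine stage_error_bound hn hlam hκ hG hξ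
      (fun i => ⟨(hrun.w_zero i).1, (hrun.w_zero i).2.trans (by norm_num)⟩)
      (hrun.beta_argmin 1 le_rfl) hres hREC hG0 (T := supp bs) subset_rfl ?_
      fun i _ => (hrun.w_zero i).2
    have : (0 : ℝ) ≤ (supp bs).card := Nat.cast_nonneg _
    linarith
  | succ k hk ih =>
    set U : Finset (Fin p) := Finset.univ.filter fun i => i ∉ supp bs ∧ 1 / 2 < w k i with hU
    refine stage_error_bound hn hlam hκ hG hξ (hrun.w_mem k hk)
      (hrun.beta_argmin (k + 1) (by omega)) hres hREC hG0 (T := supp bs ∪ U)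
      Finset.subset_union_left ?_ ?_
    · obtain ⟨hρ0, hρ3⟩ := hrun.rho_le k
      -- Each index of `U` lies off the support and contributes `(ρ_k |β_i^k|)² ≥ 1` to the
      -- right-hand side.
      have h1 : (U.card : ℝ) ≤ ρ k ^ 2 * l2norm (β k - bs) ^ 2 := by
        rw [l2norm_sq, Finset.mul_sum, Finset.card_eq_sum_ones, Nat.cast_sum]
        refine le_trans (Finset.sum_le_sum fun i hi => ?_)
          (Finset.sum_le_sum_of_subset_of_nonneg (Finset.subset_univ U)
            fun i _ _ => by positivity)
        obtain ⟨hi1, hi2⟩ := (Finset.mem_filter.mp hi).2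
        have hbs : bs i = 0 := by simpa [supp] using hi1
        have h2 := one_le_of_half_lt_weight hrun.a_gt_one hi2
          (hrun.w_argmin k hk i (1 / 2) (by norm_num))
        rw [Pi.sub_apply, hbs, sub_zero, ← sq_abs (β k i), ← mul_pow, Nat.cast_one]
        exact one_le_pow₀ h2
      have h3 : ρ k * l2norm (β k - bs) ≤ √(sparsity bs : ℝ) / √2 := by
        calc ρ k * l2norm (β k - bs)
            ≤ κ / (4 * √2 * lam) * (4 * √(sparsity bs : ℝ) * lam / κ) :=
              mul_le_mul (hρ3.trans hρ) ih (l2norm_nonneg _) (by positivity)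
          _ = √(sparsity bs : ℝ) / √2 := by field_simp
      have h4 : ρ k ^ 2 * l2norm (β k - bs) ^ 2 ≤ (sparsity bs : ℝ) / 2 := by
        rw [← mul_pow]
        refine (pow_le_pow_left₀ (mul_nonneg hρ0.le (l2norm_nonneg _)) h3 2).trans ?_
        rw [div_pow, Real.sq_sqrt (Nat.cast_nonneg _), Real.sq_sqrt (by norm_num)]
      have h5 : ((supp bs ∪ U).card : ℝ) ≤ (supp bs).card + U.card := by
        exact_mod_cast Finset.card_union_le _ _
      change _ ≤ ((supp bs).card : ℝ) / 2 at h4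
      linarith
    · intro i hi
      by_contra! h
      refine hi (Finset.mem_union.mpr ?_)
      by_cases his : i ∈ supp bs
      · exact Or.inl his
      · exact Or.inr (Finset.mem_filter.mpr ⟨Finset.mem_univ i, his, h⟩)

/-! ### The deterministic error bound for multiplicative errors -/

theorem SigmaHatMul_eq_hadamard {n p : ℕ} (Z : Matrix (Fin n) (Fin p) ℝ) (μM : Fin p → ℝ)
    (SigmaM : Matrix (Fin p) (Fin p) ℝ) :
    SigmaHatMul Z μM SigmaM = gram Z ⊙ SigmaDagger μM SigmaM := by
  ext j k
  simp [SigmaHatMul, SigmaDagger, div_eq_mul_inv]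

theorem gram_isHermitian {n p : ℕ} (Z : Matrix (Fin n) (Fin p) ℝ) : (gram Z).IsHermitian := by
  simp [Matrix.IsHermitian, gram, Matrix.conjTranspose_eq_transpose_of_trivial]

theorem SigmaDagger_isHermitian {p : ℕ} {μM : Fin p → ℝ} {SigmaM : Matrix (Fin p) (Fin p) ℝ}
    (h : SigmaM.IsHermitian) : (SigmaDagger μM SigmaM).IsHermitian := by
  ext j k
  have := h.apply j k
  simp only [star_trivial] at this
  simp [SigmaDagger, this, mul_comm (μM k)]

theorem hadamard_isHermitian {p : ℕ} {A B : Matrix (Fin p) (Fin p) ℝ} (hA : A.IsHermitian)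
    (hB : B.IsHermitian) : (A ⊙ B).IsHermitian := by
  ext j k
  have h1 := hA.apply j k
  have h2 := hB.apply j k
  simp only [star_trivial] at h1 h2
  simp [h1, h2]

theorem gram_corrupted_diag_le {n p : ℕ} {X M : Matrix (Fin n) (Fin p) ℝ} {cM : ℝ}
    (hX : ∀ j, (1 / (n : ℝ)) * ∑ i, X i j ^ 2 ≤ 1) (hM : ∀ i j, |M i j| ≤ cM) (j : Fin p) :
    gram (corrupted X M) j j ≤ cM ^ 2 := by
  have h1 : gram (corrupted X M) j j = 1 / (n : ℝ) * ∑ i, X i j ^ 2 * M i j ^ 2 := by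
    simp only [gram, corrupted, Matrix.smul_apply, Matrix.mul_apply, Matrix.transpose_apply,
      Matrix.hadamard_apply, smul_eq_mul]
    congr 1
    exact Finset.sum_congr rfl fun i _ => by ring
  have h2 : 1 / (n : ℝ) * ∑ i, X i j ^ 2 * M i j ^ 2 ≤
      1 / (n : ℝ) * ∑ i, X i j ^ 2 * cM ^ 2 := by
    refine mul_le_mul_of_nonneg_left (Finset.sum_le_sum fun i _ => ?_) (by positivity)
    refine mul_le_mul_of_nonneg_left ?_ (sq_nonneg _)
    rw [← sq_abs (M i j)]
    exact pow_le_pow_left₀ (abs_nonneg _) (hM i j) 2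
  rw [h1]
  refine h2.trans ?_
  rw [← Finset.sum_mul, ← mul_assoc]
  exact mul_le_of_le_one_left (sq_nonneg _) (hX j)

theorem gram_mulVec {n p : ℕ} (X : Matrix (Fin n) (Fin p) ℝ) (b : Fin p → ℝ) (j : Fin p) :
    (gram X *ᵥ b) j = 1 / (n : ℝ) * ∑ i, X i j * (X *ᵥ b) i := by
  rw [gram, Matrix.smul_mulVec, ← Matrix.mulVec_mulVec]
  rfl

theorem IsRun.error_bound_of_deviation_le {n p : ℕ} (hn : 0 < n) {X M : Matrix (Fin n) (Fin p) ℝ}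
    {e : Fin n → ℝ} {βs : Fin p → ℝ} (hβs : βs ≠ 0) {μM : Fin p → ℝ}
    {SigmaM : Matrix (Fin p) (Fin p) ℝ} (hSigma : SigmaM.IsHermitian) {cM κ epsHat : ℝ}
    (heps : 0 < epsHat) (hX : ∀ j, (1 / (n : ℝ)) * ∑ i, X i j ^ 2 ≤ 1)
    (hM : ∀ i j, |M i j| ≤ cM) (hREC : REC (gram X) κ (supp βs))
    (hdev : ∀ j k, |(SigmaHatMul (corrupted X M) μM SigmaM - gram X) j k| ≤
      min (κ / 48) (epsHat / 3) / sparsity βs)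
    (hsig : ∀ j, |1 / (n : ℝ) * ∑ i, X i j * M i j * (X *ᵥ βs) i / μM j -
      1 / (n : ℝ) * ∑ i, X i j * (X *ᵥ βs) i| ≤ epsHat * l1norm βs / 3)
    (hnoise : ∀ j, |1 / (n : ℝ) * ∑ i, X i j * M i j / μM j * e i| ≤ epsHat * l1norm βs / 3)
    {a lam : ℝ} {ρ : ℕ → ℝ} {w β : ℕ → Fin p → ℝ}
    (hrun : IsRun n (calibratedZ n epsHat (SigmaHatMul (corrupted X M) μM SigmaM))
      (calibratedY n epsHat (SigmaHatMul (corrupted X M) μM SigmaM)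
        (xiHatMul (corrupted X M) (response X βs e) μM)) a lam ρ w β)
    (hlam : 8 * KTilde epsHat cM μM SigmaM βs ≤ lam) (hρ : ρ 3 ≤ κ / (4 * √2 * lam)) :
    ∀ k, 1 ≤ k → l2norm (β k - βs) ≤ 4 * √(sparsity βs : ℝ) * lam / κ := by
  set A := SigmaHatMul (corrupted X M) μM SigmaM with hAdef
  set ξ := xiHatMul (corrupted X M) (response X βs e) μM with hξdef
  set m := min (lambdaMin (SigmaDagger μM SigmaM)) 0 * cM ^ 2 with hm
  have hm0 : m ≤ 0 := mul_nonpos_of_nonpos_of_nonneg (min_le_right _ _) (sq_nonneg _)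
  have hAeq := SigmaHatMul_eq_hadamard (corrupted X M) μM SigmaM
  have hA : A.IsHermitian := by
    rw [hAdef, hAeq]
    exact hadamard_isHermitian (gram_isHermitian _) (SigmaDagger_isHermitian hSigma)
  have hspec : ∀ x ∈ spectrum ℝ A, m ≤ x := fun x hx => by
    refine le_of_mem_spectrum hA (fun v => ?_) hx
    rw [hAdef, hAeq]
    exact quadratic_hadamard_gram_ge (SigmaDagger_isHermitian hSigma)
      (gram_corrupted_diag_le hX hM) v
  have hS : (supp βs).Nonempty := by
    obtain ⟨i, hi⟩ := Function.ne_iff.mp hβs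
    exact ⟨i, by simpa [supp] using hi⟩
  have hs1 : (1 : ℝ) ≤ sparsity βs := by
    exact_mod_cast Nat.one_le_iff_ne_zero.mpr hS.card_pos.ne'
  have hs0 : (0 : ℝ) < sparsity βs := by linarith
  have hl0 : 0 ≤ l1norm βs := Finset.sum_nonneg fun _ _ => abs_nonneg _
  have hcal : ∀ j k, |(calibratedGram epsHat A - A) j k| ≤ epsHat - m := by
    refine abs_entry_le ?_ (fun v => ?_) fun v => ?_
    · have hA' : Aᵀ = A := hA
      rw [Matrix.transpose_sub, calibratedGram, transpose_cfc, hA']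
    · rw [Matrix.sub_mulVec, dotProduct_sub, sub_nonneg]
      exact quadratic_le_calibratedGram hA v
    · rw [Matrix.sub_mulVec, dotProduct_sub]
      linarith [calibratedGram_quadratic_le hm0 heps hA hspec v]
  -- The deviation bound is used twice: with `κ/(48s)` for the restricted eigenvalues, and, dropping
  -- `1/s ≤ 1`, with `ε̂/3` for the residual.
  have hdev1 : ∀ j k, |(A - gram X) j k| ≤ κ / (48 * (supp βs).card) := fun j k => by
    refine (hdev j k).trans ?_
    rw [← div_div]
    exact div_le_div_of_nonneg_right (min_le_left _ _) hs0.le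
  have hdev2 : ∀ j k, |(A - gram X) j k| ≤ epsHat / 3 := fun j k =>
    (hdev j k).trans ((div_le_div_of_nonneg_right (min_le_right _ _) hs0.le).trans
      (div_le_self (by linarith) hs1))
  have hξ : ∀ j, |(ξ - gram X *ᵥ βs) j| ≤ 2 * (epsHat * l1norm βs / 3) := fun j => by
    have h1 : (ξ - gram X *ᵥ βs) j =
        (1 / (n : ℝ) * ∑ i, X i j * M i j * (X *ᵥ βs) i / μM j -
          1 / (n : ℝ) * ∑ i, X i j * (X *ᵥ βs) i) +
        1 / (n : ℝ) * ∑ i, X i j * M i j / μM j * e i := by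
      have h2 : ξ j = 1 / (n : ℝ) * ∑ i, X i j * M i j * (X *ᵥ βs) i / μM j +
          1 / (n : ℝ) * ∑ i, X i j * M i j / μM j * e i := by
        rw [hξdef, ← mul_add, ← Finset.sum_add_distrib, xiHatMul, mul_div_assoc]
        congr 1
        rw [Matrix.mulVec, dotProduct, Finset.sum_div]
        refine Finset.sum_congr rfl fun i _ => ?_
        simp only [corrupted, response, Matrix.transpose_apply, Matrix.hadamard_apply,
          Pi.add_apply]
        ring
      rw [Pi.sub_apply, gram_mulVec, h2]
      ring
    rw [h1]
    refine (abs_add_le _ _).trans ?_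
    linarith [hsig j, hnoise j]
  refine hrun.error_bound hn hREC.1 (calibratedZ_gram heps A)
    (calibratedZ_mulVec_calibratedY heps hA ξ) (fun j => ?_) (fun v hv => ?_) (fun v => ?_) hρ
  · have h1 : (ξ - calibratedGram epsHat A *ᵥ βs) j = (ξ - gram X *ᵥ βs) j -
        ((A - gram X) *ᵥ βs) j - ((calibratedGram epsHat A - A) *ᵥ βs) j := by
      simp only [Matrix.sub_mulVec, Pi.sub_apply]
      ring
    have h2 := hξ j
    have h3 := abs_mulVec_le hdev2 βs j
    have h4 := abs_mulVec_le hcal βs j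
    have h5 : 8 * (2 * (epsHat - m) * l1norm βs) ≤ lam := hlam
    -- The pieces add up to `ε̂‖β*‖₁ + (ε̂ - m)‖β*‖₁`, and `m ≤ 0` absorbs this into `2(ε̂ - m)‖β*‖₁
    -- = K̃`.
    have h6 : m * l1norm βs ≤ 0 := mul_nonpos_of_nonpos_of_nonneg hm0 hl0
    rw [h1]
    refine (abs_sub _ _).trans ?_
    have h7 := abs_sub ((ξ - gram X *ᵥ βs) j) (((A - gram X) *ᵥ βs) j)
    nlinarith
  · exact (REC_perturbation hREC hS hdev1 v hv).trans (quadratic_le_calibratedGram hA v)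
  · have h := cfc_quadratic_mono (A := A) (f := fun _ => (0 : ℝ)) (g := fun x => max x epsHat)
      continuous_const (by fun_prop) (fun x _ => heps.le.trans (le_max_right _ _)) v
    have hA' : IsSelfAdjoint A := hA
    rwa [cfc_const_zero ℝ A, Matrix.zero_mulVec, dotProduct_zero] at h

/-! ### Concentration -/

section Concentration

variable {Ω : Type*} [MeasurableSpace Ω] {P : Measure Ω}

theorem hasSubgaussianMGF_mono {X : Ω → ℝ} {c c' : ℝ≥0} (h : HasSubgaussianMGF X c P)
    (hc : c ≤ c') : HasSubgaussianMGF X c' P where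
  integrable_exp_mul := h.integrable_exp_mul
  mgf_le t := (h.mgf_le t).trans (Real.exp_le_exp.mpr (by gcongr))

/-- A random variable on a product space is sub-Gaussian if it is so conditionally on the first
coordinate, with a common parameter. -/
theorem hasSubgaussianMGF_prod {α β : Type*} [MeasurableSpace α] [MeasurableSpace β]
    {μ : Measure α} {ν : Measure β} [IsProbabilityMeasure μ] [IsProbabilityMeasure ν]
    {F : α × β → ℝ} (hF : Measurable F) {c : ℝ≥0}
    (h : ∀ᵐ a ∂μ, HasSubgaussianMGF (fun b => F (a, b)) c ν) :
    HasSubgaussianMGF F c (μ.prod ν) := by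
  have hmeas : ∀ t : ℝ, Measurable fun z => Real.exp (t * F z) := fun t => by fun_prop
  have hint : ∀ t : ℝ, Integrable (fun z => Real.exp (t * F z)) (μ.prod ν) := fun t => by
    rw [integrable_prod_iff (hmeas t).aestronglyMeasurable]
    refine ⟨h.mono fun a ha => ha.integrable_exp_mul t,
      Integrable.of_bound (C := Real.exp (c * t ^ 2 / 2))
        (hmeas t).norm.aestronglyMeasurable.integral_prod_right' (h.mono fun a ha => ?_)⟩
    simp only [Real.norm_eq_abs, Real.abs_exp]
    rw [abs_of_nonneg (integral_nonneg fun _ => (Real.exp_pos _).le)]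
    exact ha.mgf_le t
  refine ⟨hint, fun t => ?_⟩
  rw [mgf, integral_prod _ (hint t)]
  calc ∫ a, ∫ b, Real.exp (t * F (a, b)) ∂ν ∂μ
      ≤ ∫ _, Real.exp (c * t ^ 2 / 2) ∂μ :=
        integral_mono_ae (hint t).integral_prod_left (integrable_const _)
          (h.mono fun a ha => ha.mgf_le t)
    _ = _ := by simp

theorem measureReal_lt_abs_le [IsProbabilityMeasure P] {X : Ω → ℝ} {c : ℝ≥0}
    (h : HasSubgaussianMGF X c P) {t : ℝ} (ht : 0 ≤ t) :
    P.real {ω | t < |X ω|} ≤ 2 * Real.exp (-t ^ 2 / (2 * c)) := by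
  have hsub : {ω | t < |X ω|} ⊆ {ω | t ≤ X ω} ∪ {ω | t ≤ (-X) ω} := fun ω hω => by
    rw [Set.mem_ofPred_eq, lt_abs] at hω
    rcases hω with h | h
    · exact Or.inl h.le
    · exact Or.inr h.le
  calc P.real {ω | t < |X ω|} ≤ P.real ({ω | t ≤ X ω} ∪ {ω | t ≤ (-X) ω}) :=
        measureReal_mono hsub
    _ ≤ P.real {ω | t ≤ X ω} + P.real {ω | t ≤ (-X) ω} := measureReal_union_le _ _
    _ ≤ _ := by
        have h1 := h.measure_ge_le ht
        have h2 := h.neg.measure_ge_le ht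
        linarith

theorem average_tail [IsProbabilityMeasure P] {n : ℕ} (hn : 0 < n) {S : Ω → ℝ} {c : ℝ≥0}
    (h : HasSubgaussianMGF S (n * c) P) {t : ℝ} (ht : 0 ≤ t) :
    P.real {ω | t < |1 / (n : ℝ) * S ω|} ≤ 2 * Real.exp (-(n * t ^ 2 / (2 * c))) := by
  have hn' : (0 : ℝ) < n := by exact_mod_cast hn
  have h1 := measureReal_lt_abs_le h (t := n * t) (by positivity)
  have h2 : {ω | t < |1 / (n : ℝ) * S ω|} = {ω | n * t < |S ω|} := by
    ext ω
    simp only [Set.mem_ofPred_eq]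
    rw [abs_mul, abs_of_pos (by positivity), one_div_mul_eq_div, lt_div_iff₀ hn', mul_comm t]
  rw [h2]
  refine h1.trans (le_of_eq ?_)
  congr 2
  push_cast
  -- For `c = 0` both exponents are `0` by the convention for division by zero.
  rcases eq_or_ne (c : ℝ) 0 with h0 | h0
  · simp [h0]
  · field_simp

/-- Hoeffding's inequality for averages of independent bounded random variables. -/
theorem hoeffding_average [IsProbabilityMeasure P] {n : ℕ} (hn : 0 < n) {Y : Fin n → Ω → ℝ}
    (hind : iIndepFun Y P) (hmeas : ∀ i, Measurable (Y i)) {B : ℝ}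
    (hB : ∀ i, ∀ᵐ ω ∂P, |Y i ω| ≤ B) {m : Fin n → ℝ} (hm : ∀ i, ∫ ω, Y i ω ∂P = m i)
    {t : ℝ} (ht : 0 ≤ t) :
    P.real {ω | t < |1 / (n : ℝ) * ∑ i, Y i ω - 1 / (n : ℝ) * ∑ i, m i|} ≤
      2 * Real.exp (-(n * t ^ 2 / (2 * B ^ 2))) := by
  have h1 : ∀ i ∈ Finset.univ, HasSubgaussianMGF (fun ω => Y i ω - m i) (‖B‖₊ ^ 2) P :=
    fun i _ => by
      have h := hasSubgaussianMGF_of_mem_Icc (μ := P) (hmeas i).aemeasurable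
        ((hB i).mono fun ω hω => abs_le.mp hω)
      rw [hm i] at h
      convert h using 2
      rw [sub_neg_eq_add, ← two_mul, nnnorm_mul, Real.nnnorm_ofNat,
        mul_div_cancel_left₀ _ (by norm_num : (2 : ℝ≥0) ≠ 0)]
  have h2 : iIndepFun (fun i ω => Y i ω - m i) P :=
    hind.comp (fun i y => y - m i) fun i => measurable_id.sub_const _
  have h3 := HasSubgaussianMGF.sum_of_iIndepFun h2 h1
  rw [Finset.sum_const, Finset.card_univ, Fintype.card_fin, nsmul_eq_mul] at h3
  have h4 := average_tail hn h3 ht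
  simpa only [Finset.sum_sub_distrib, mul_sub, NNReal.coe_pow, coe_nnnorm, Real.norm_eq_abs,
    sq_abs] using h4

/-- Weighted sums of sub-Gaussian noise with independent, bounded random weights. -/
theorem hasSubgaussianMGF_weighted_sum [IsProbabilityMeasure P] {n : ℕ} {α : Type*}
    [MeasurableSpace α] {M : Ω → α} {ε : Ω → Fin n → ℝ} {σ : ℝ≥0}
    (hM : Measurable M) (hε : IsSubGaussianNoise P ε σ) (hMε : IndepFun M ε P)
    {w : α → Fin n → ℝ} (hw : Measurable w) {B : ℝ} (hB : ∀ᵐ ω ∂P, ∀ i, |w (M ω) i| ≤ B) :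
    HasSubgaussianMGF (fun ω => ∑ i, w (M ω) i * ε ω i) (n * (‖B‖₊ ^ 2 * σ ^ 2)) P := by
  have hεm : Measurable ε := measurable_pi_iff.mpr hε.measurable
  have hw' : ∀ i, Measurable fun a => w a i := measurable_pi_iff.mp hw
  have : IsProbabilityMeasure (P.map M) := Measure.isProbabilityMeasure_map hM.aemeasurable
  have : IsProbabilityMeasure (P.map ε) := Measure.isProbabilityMeasure_map hεm.aemeasurable
  let F : α × (Fin n → ℝ) → ℝ := fun z => ∑ i, w z.1 i * z.2 i
  have hF : Measurable F := Finset.measurable_sum _ fun i _ =>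
    ((hw' i).comp measurable_fst).mul ((measurable_pi_apply i).comp measurable_snd)
  have hset : MeasurableSet {a | ∀ i, |w a i| ≤ B} := by
    rw [Set.ofPred_forall]
    exact MeasurableSet.iInter fun i => measurableSet_le (hw' i).abs measurable_const
  -- Independence turns the joint law of `(M, ε)` into a product, so the weights can be frozen at
  -- almost every value of `M`.
  have hprod : HasSubgaussianMGF F (n * (‖B‖₊ ^ 2 * σ ^ 2)) ((P.map M).prod (P.map ε)) := by
    refine hasSubgaussianMGF_prod hF (((ae_map_iff hM.aemeasurable hset).mpr hB).mono
      fun a ha => ?_)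
    have h1 : ∀ i ∈ Finset.univ,
        HasSubgaussianMGF (fun ω => w a i * ε ω i) (‖B‖₊ ^ 2 * σ ^ 2) P := fun i _ => by
      have hq : w a i ^ 2 ≤ ‖B‖ ^ 2 := by
        rw [← sq_abs (w a i)]
        exact pow_le_pow_left₀ (abs_nonneg _) ((ha i).trans (le_abs_self B)) 2
      have hq' : (⟨w a i ^ 2, sq_nonneg _⟩ : ℝ≥0) ≤ ‖B‖₊ ^ 2 := hq
      exact hasSubgaussianMGF_mono ((hε.subGaussian i).const_mul (w a i))
        (mul_le_mul_left hq' _)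
    have h2 : iIndepFun (fun i ω => w a i * ε ω i) P :=
      hε.indep.comp (fun i y => w a i * y) fun i => measurable_id.const_mul _
    have h3 := HasSubgaussianMGF.sum_of_iIndepFun h2 h1
    rw [Finset.sum_const, Finset.card_univ, Fintype.card_fin, nsmul_eq_mul] at h3
    have hFa : Measurable fun e => F (a, e) := hF.comp measurable_prodMk_left
    exact h3.congr_identDistrib ⟨(hFa.comp hεm).aemeasurable, hFa.aemeasurable,
      (Measure.map_map hFa hεm).symm⟩
  rw [← (indepFun_iff_map_prod_eq_prod_map_map hM.aemeasurable hεm.aemeasurable).mp hMε] at hprod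
  exact HasSubgaussianMGF.of_map (X := F) (hM.prodMk hεm).aemeasurable hprod

end Concentration

/-! ### Deviations of the surrogates -/

section Deviation

variable {Ω : Type*} [MeasurableSpace Ω] {P : Measure Ω} {n p : ℕ}
  {M : Ω → Matrix (Fin n) (Fin p) ℝ} {μM : Fin p → ℝ} {SigmaM : Matrix (Fin p) (Fin p) ℝ}
  {σ τ : ℝ≥0} {cX cM : ℝ}

theorem IsErrorMatrix.measurable_entry (hM : IsErrorMatrix P M μM SigmaM τ) (i : Fin n)
    (j : Fin p) : Measurable fun ω => M ω i j :=
  measurable_pi_iff.mp (hM.measurable i) j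

theorem IsErrorMatrix.memLp_entry [IsProbabilityMeasure P] (hM : IsErrorMatrix P M μM SigmaM τ)
    (hcM : ∀ᵐ ω ∂P, ∀ i j, |M ω i j| ≤ cM) (i : Fin n) (j : Fin p) :
    MemLp (fun ω => M ω i j) 2 P :=
  MemLp.of_bound (hM.measurable_entry i j).aestronglyMeasurable cM (hcM.mono fun _ h => h i j)

theorem IsErrorMatrix.isHermitian (hM : IsErrorMatrix P M μM SigmaM τ) (hn : 0 < n) :
    SigmaM.IsHermitian := by
  ext j k
  rw [Matrix.conjTranspose_apply, star_trivial, ← hM.cov ⟨0, hn⟩ k j, ← hM.cov ⟨0, hn⟩ j k,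
    covariance_comm]

theorem IsErrorMatrix.integral_mul [IsProbabilityMeasure P] (hM : IsErrorMatrix P M μM SigmaM τ)
    (hcM : ∀ᵐ ω ∂P, ∀ i j, |M ω i j| ≤ cM) (i : Fin n) (j k : Fin p) :
    ∫ ω, M ω i j * M ω i k ∂P = SigmaM j k + μM j * μM k := by
  have h := covariance_eq_sub (hM.memLp_entry hcM i j) (hM.memLp_entry hcM i k)
  rw [hM.cov, hM.mean, hM.mean] at h
  rw [h]
  simp

theorem IsErrorMatrix.iIndepFun_row (hM : IsErrorMatrix P M μM SigmaM τ)
    {g : Fin n → (Fin p → ℝ) → ℝ} (hg : ∀ i, Measurable (g i)) :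
    iIndepFun (fun i ω => g i (fun j => M ω i j)) P :=
  hM.indep.comp g hg

/-- Division by `Σ_M + μ_M μ_Mᵀ`, the second moment of a row of `M`, makes each entry of the
surrogate unbiased; it is then an average of independent bounded row terms. -/
theorem SigmaHatMul_deviation [IsProbabilityMeasure P] (hn : 0 < n)
    (hM : IsErrorMatrix P M μM SigmaM τ) (hcM : ∀ᵐ ω ∂P, ∀ i j, |M ω i j| ≤ cM)
    {X : Matrix (Fin n) (Fin p) ℝ} (hcX : ∀ i j, |X i j| ≤ cX) {d : ℝ} (hd : 0 < d)
    (hμM : ∀ j, 0 < μM j) (hSigma : ∀ j k, d ≤ SigmaM j k) {t : ℝ} (ht : 0 ≤ t) (j k : Fin p) :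
    P.real {ω | t < |(SigmaHatMul (corrupted X (M ω)) μM SigmaM - gram X) j k|} ≤
      2 * Real.exp (-(n * t ^ 2 / (2 * (cX ^ 2 * cM ^ 2 / d) ^ 2))) := by
  set D := SigmaM j k + μM j * μM k with hD
  have hdD : d ≤ D := by
    have := mul_pos (hμM j) (hμM k)
    linarith [hSigma j k]
  have hD0 : 0 < D := hd.trans_le hdD
  let g : Fin n → (Fin p → ℝ) → ℝ := fun i v => X i j * v j * (X i k * v k) / D
  have hg : ∀ i, Measurable (g i) := fun i => by fun_prop
  have h := hoeffding_average (P := P) hn (hM.iIndepFun_row hg)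
    (fun i => (hg i).comp (hM.measurable i)) (B := cX ^ 2 * cM ^ 2 / d)
    (fun i => hcM.mono fun ω hω => ?_) (m := fun i => X i j * X i k) (fun i => ?_) ht
  · convert h using 6 with ω
    simp only [SigmaHatMul, gram, corrupted, Matrix.sub_apply, Matrix.of_apply,
      Matrix.smul_apply, Matrix.mul_apply, Matrix.transpose_apply, Matrix.hadamard_apply,
      smul_eq_mul, g, ← Finset.sum_div, hD]
    rw [mul_div_assoc]
  · have h1 : |X i j * M ω i j| ≤ cX * cM := by
      rw [abs_mul]
      exact mul_le_mul (hcX i j) (hω i j) (abs_nonneg _) ((abs_nonneg _).trans (hcX i j))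
    have h2 : |X i k * M ω i k| ≤ cX * cM := by
      rw [abs_mul]
      exact mul_le_mul (hcX i k) (hω i k) (abs_nonneg _) ((abs_nonneg _).trans (hcX i k))
    have h3 : |X i j * M ω i j * (X i k * M ω i k)| ≤ cX ^ 2 * cM ^ 2 := by
      rw [abs_mul]
      exact (mul_le_mul h1 h2 (abs_nonneg _) ((abs_nonneg _).trans h1)).trans_eq (by ring)
    change |X i j * M ω i j * (X i k * M ω i k) / D| ≤ _
    rw [abs_div, abs_of_pos hD0]
    exact div_le_div₀ ((abs_nonneg _).trans h3) h3 hd hdD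
  · have h1 : ∀ ω, g i (fun j => M ω i j) = X i j * X i k / D * (M ω i j * M ω i k) :=
      fun ω => by simp only [g]; ring
    simp only [h1]
    rw [integral_const_mul, hM.integral_mul hcM, ← hD, div_mul_cancel₀ _ hD0.ne']

theorem signal_deviation [IsProbabilityMeasure P] (hn : 0 < n)
    (hM : IsErrorMatrix P M μM SigmaM τ) (hcM : ∀ᵐ ω ∂P, ∀ i j, |M ω i j| ≤ cM)
    {X : Matrix (Fin n) (Fin p) ℝ} (hcX : ∀ i j, |X i j| ≤ cX) {u : ℝ} (hu : 0 < u)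
    (hμM : ∀ j, u ≤ μM j) (b : Fin p → ℝ) {t : ℝ} (ht : 0 ≤ t) (j : Fin p) :
    P.real {ω | t < |1 / (n : ℝ) * ∑ i, X i j * M ω i j * (X *ᵥ b) i / μM j -
      1 / (n : ℝ) * ∑ i, X i j * (X *ᵥ b) i|} ≤
      2 * Real.exp (-(n * t ^ 2 / (2 * (cX * cM * (cX * l1norm b) / u) ^ 2))) := by
  have hμ0 : 0 < μM j := hu.trans_le (hμM j)
  let g : Fin n → (Fin p → ℝ) → ℝ := fun i v => X i j * v j * (X *ᵥ b) i / μM j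
  have hg : ∀ i, Measurable (g i) := fun i => by fun_prop
  refine hoeffding_average (P := P) hn (hM.iIndepFun_row hg)
    (fun i => (hg i).comp (hM.measurable i)) (B := cX * cM * (cX * l1norm b) / u)
    (fun i => hcM.mono fun ω hω => ?_) (m := fun i => X i j * (X *ᵥ b) i) (fun i => ?_) ht
  · have h1 : |X i j * M ω i j| ≤ cX * cM := by
      rw [abs_mul]
      exact mul_le_mul (hcX i j) (hω i j) (abs_nonneg _) ((abs_nonneg _).trans (hcX i j))
    have h2 : |(X *ᵥ b) i| ≤ cX * l1norm b := by
      rw [l1norm, Finset.mul_sum, Matrix.mulVec, dotProduct]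
      refine (Finset.abs_sum_le_sum_abs _ _).trans (Finset.sum_le_sum fun k _ => ?_)
      rw [abs_mul]
      exact mul_le_mul_of_nonneg_right (hcX i k) (abs_nonneg _)
    change |X i j * M ω i j * (X *ᵥ b) i / μM j| ≤ _
    have h3 : |X i j * M ω i j * (X *ᵥ b) i| ≤ cX * cM * (cX * l1norm b) := by
      rw [abs_mul]
      exact mul_le_mul h1 h2 (abs_nonneg _) ((abs_nonneg _).trans h1)
    rw [abs_div, abs_of_pos hμ0]
    exact div_le_div₀ ((abs_nonneg _).trans h3) h3 hu (hμM j)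
  · have h1 : ∀ ω, g i (fun j => M ω i j) = X i j * (X *ᵥ b) i / μM j * M ω i j :=
      fun ω => by simp only [g]; ring
    simp only [h1]
    rw [integral_const_mul, hM.mean, div_mul_cancel₀ _ hμ0.ne']

theorem noise_deviation [IsProbabilityMeasure P] (hn : 0 < n)
    (hM : IsErrorMatrix P M μM SigmaM τ) (hcM : ∀ᵐ ω ∂P, ∀ i j, |M ω i j| ≤ cM)
    {ε : Ω → Fin n → ℝ} (hε : IsSubGaussianNoise P ε σ)
    (hMε : IndepFun (fun ω => (fun i j => M ω i j : Fin n → Fin p → ℝ)) ε P)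
    {X : Matrix (Fin n) (Fin p) ℝ} (hcX : ∀ i j, |X i j| ≤ cX) {u : ℝ} (hu : 0 < u)
    (hμM : ∀ j, u ≤ μM j) {t : ℝ} (ht : 0 ≤ t) (j : Fin p) :
    P.real {ω | t < |1 / (n : ℝ) * ∑ i, X i j * M ω i j / μM j * ε ω i|} ≤
      2 * Real.exp (-(n * t ^ 2 / (2 * ((cX * cM / u) ^ 2 * (σ : ℝ) ^ 2)))) := by
  have hμ0 : 0 < μM j := hu.trans_le (hμM j)
  have hMm : Measurable fun ω => (fun i j => M ω i j : Fin n → Fin p → ℝ) :=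
    measurable_pi_iff.mpr hM.measurable
  have h := hasSubgaussianMGF_weighted_sum hMm hε hMε
    (w := fun m i => X i j * m i j / μM j) (by fun_prop) (B := cX * cM / u)
    (hcM.mono fun ω hω i => by
      have h1 : |X i j * M ω i j| ≤ cX * cM := by
        rw [abs_mul]
        exact mul_le_mul (hcX i j) (hω i j) (abs_nonneg _) ((abs_nonneg _).trans (hcX i j))
      rw [abs_div, abs_of_pos hμ0]
      exact div_le_div₀ ((abs_nonneg _).trans h1) h1 hu (hμM j))
  have h2 := average_tail hn h ht
  simpa only [NNReal.coe_mul, NNReal.coe_pow, coe_nnnorm, Real.norm_eq_abs, sq_abs] using h2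

end Deviation

/-! ### The rate -/

/-- The scale `ζ` of the exponent, as a function of
`β*, τ², σ², κ, λ_min(Σ_M†), c_X, c_M, min Σ_M, min μ_M, ε̂`. -/
def rateScale (b : ℕ → ℝ) (_τ2 σ2 κ _lmin cX cM d u e : ℝ) : ℝ :=
  -- One term per family of deviations: twice the variance proxy over the squared tolerance. The `1`
  -- and the absolute value of `σ2` give positivity for all real arguments.
  1 + 2 * (cX ^ 2 * cM ^ 2 / d) ^ 2 / min (κ / 48) (e / 3) ^ 2
    + 2 * (cX * cM * (cX * ∑' i, |b i|) / u) ^ 2 / (e * (∑' i, |b i|) / 3) ^ 2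
    + 2 * ((cX * cM / u) ^ 2 * |σ2|) / (e * (∑' i, |b i|) / 3) ^ 2

theorem rateScale_pos (b : ℕ → ℝ) (τ2 σ2 κ lmin cX cM d u e : ℝ) :
    0 < rateScale b τ2 σ2 κ lmin cX cM d u e := by
  unfold rateScale
  positivity

theorem tsum_abs_zeroExtend {p : ℕ} (b : Fin p → ℝ) : ∑' i, |zeroExtend b i| = l1norm b := by
  rw [tsum_eq_sum (s := Finset.range p)
    (fun i hi => by simp [zeroExtend, Finset.mem_range.not.mp hi]), ← Fin.sum_univ_eq_sum_range]
  exact Finset.sum_congr rfl fun i _ => by simp [zeroExtend]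

/-- Brings all tails to one exponent. Only the deviation of `Σ̂` needs a tolerance of order `1/s`;
the others satisfy `u / s ≤ t` because `s ≥ 1`. -/
theorem rate_le {n s ζ t u V : ℝ} (hn : 0 < n) (hs : 0 < s) (hu : 0 < u) (hV : 0 < V)
    (ht : u / s ≤ t) (hζ : 2 * V / u ^ 2 ≤ ζ) :
    1 * n * (s ^ 2)⁻¹ * ζ⁻¹ ≤ n * t ^ 2 / (2 * V) := by
  have h1 : ζ⁻¹ ≤ (2 * V / u ^ 2)⁻¹ := inv_anti₀ (by positivity) hζ
  have h2 : (u / s) ^ 2 ≤ t ^ 2 := pow_le_pow_left₀ (by positivity) ht 2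
  calc 1 * n * (s ^ 2)⁻¹ * ζ⁻¹ ≤ 1 * n * (s ^ 2)⁻¹ * (2 * V / u ^ 2)⁻¹ :=
        mul_le_mul_of_nonneg_left h1 (by positivity)
    _ = n * (u / s) ^ 2 / (2 * V) := by field_simp
    _ ≤ _ := by gcongr

end CaZnRLS

end

/-! ### Union bound over the deviation events -/

theorem corollary3 :
    -- `C`, `c` are universal; `ζ` is a positive function of
    -- `β*, τ², σ², κ, λ_min(Σ_M†), c_X, c_M, min Σ_M, min μ_M, ε̂`
    ∃ C c : ℝ, 0 < C ∧ 0 < c ∧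
    ∃ ζ : (ℕ → ℝ) → ℝ → ℝ → ℝ → ℝ → ℝ → ℝ → ℝ → ℝ → ℝ → ℝ,
      (∀ b t₁ t₂ t₃ t₄ t₅ t₆ t₇ t₈ t₉, 0 < ζ b t₁ t₂ t₃ t₄ t₅ t₆ t₇ t₈ t₉) ∧
    ∀ (n p : ℕ) (_hn : 0 < n)
      (X : Matrix (Fin n) (Fin p) ℝ) (βs : Fin p → ℝ) (_hβs : βs ≠ 0)
      (μM : Fin p → ℝ) (SigmaM : Matrix (Fin p) (Fin p) ℝ)
      (σ τ : ℝ≥0) (_hσ : 0 < σ) (_hτ : 0 < τ)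
      (cX cM κ epsHat : ℝ) (_hepsHat : 0 < epsHat)
      (Ω : Type*) [MeasurableSpace Ω] (P : Measure Ω) [IsProbabilityMeasure P]
      (M : Ω → Matrix (Fin n) (Fin p) ℝ) (ε : Ω → Fin n → ℝ)
      -- the columns of `X` are normalized
      (_hnorm : ∀ j, (1 / (n : ℝ)) * ∑ i, X i j ^ 2 ≤ 1)
      -- the model for the noise and for the multiplicative errors
      (_hε : CaZnRLS.IsSubGaussianNoise P ε σ)
      (_hM : CaZnRLS.IsErrorMatrix P M μM SigmaM τ)
      (_hMε : IndepFun (fun ω => (fun i j => M ω i j : Fin n → Fin p → ℝ)) ε P)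
      (_hcX : ∀ i j, |X i j| ≤ cX)
      (_hcM : ∀ᵐ ω ∂P, ∀ i j, |M ω i j| ≤ cM)
      (_hSigmaM : ∀ j k, 0 < SigmaM j k)
      (_hμM : ∀ j, 0 < μM j)
      -- the restricted eigenvalue condition
      (_hREC : CaZnRLS.REC (CaZnRLS.gram X) κ (CaZnRLS.supp βs)),
      ∃ E : Set Ω, MeasurableSet E ∧
        1 - C * (p : ℝ) ^ 2 * Real.exp (-(c * n * ((CaZnRLS.sparsity βs : ℝ) ^ 2)⁻¹ *
          (ζ (CaZnRLS.zeroExtend βs) ((τ : ℝ) ^ 2) ((σ : ℝ) ^ 2) κ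
            (CaZnRLS.lambdaMin (CaZnRLS.SigmaDagger μM SigmaM)) cX cM
            (⨅ jk : Fin p × Fin p, SigmaM jk.1 jk.2) (⨅ j, μM j) epsHat)⁻¹)) ≤ P.real E ∧
        -- on `E`, the error bound holds for all iterates of every run of the algorithm
        ∀ ω ∈ E, ∀ (a lam : ℝ) (ρ : ℕ → ℝ) (w β : ℕ → Fin p → ℝ),
          CaZnRLS.IsRun n
            (CaZnRLS.calibratedZ n epsHat
              (CaZnRLS.SigmaHatMul (CaZnRLS.corrupted X (M ω)) μM SigmaM))
            (CaZnRLS.calibratedY n epsHat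
              (CaZnRLS.SigmaHatMul (CaZnRLS.corrupted X (M ω)) μM SigmaM)
              (CaZnRLS.xiHatMul (CaZnRLS.corrupted X (M ω)) (CaZnRLS.response X βs (ε ω)) μM))
            a lam ρ w β →
          8 * CaZnRLS.KTilde epsHat cM μM SigmaM βs ≤ lam →
          ρ 3 ≤ κ / (4 * √2 * lam) →
          ∀ k, 1 ≤ k → CaZnRLS.l2norm (β k - βs) ≤
            4 * √(CaZnRLS.sparsity βs : ℝ) * lam / κ := by
  -- There are `p² + p + p ≤ 3p²` two-sided tail events, each of probability at most `2q`, hence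
  -- `6`. Replacing `cX`, `cM` by `|cX| + 1`, `|cM| + 1` keeps the variance proxies strictly
  -- positive.
  refine ⟨6, 1, by norm_num, one_pos,
    fun b τ2 σ2 κ l cX cM d u e => CaZnRLS.rateScale b τ2 σ2 κ l (|cX| + 1) (|cM| + 1) d u e,
    fun b τ2 σ2 κ l cX cM d u e => CaZnRLS.rateScale_pos b τ2 σ2 κ l _ _ d u e, ?_⟩
  intro n p hn X βs hβs μM SigmaM σ τ hσ _ cX cM κ epsHat heps Ω _ P _ M ε hnorm hε hM hMε
    hcX hcM hSigmaM hμM hREC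
  obtain ⟨i₀, hi₀⟩ := Function.ne_iff.mp hβs
  have hp : 1 ≤ p := i₀.pos
  have : Nonempty (Fin p) := ⟨i₀⟩
  set d := ⨅ jk : Fin p × Fin p, SigmaM jk.1 jk.2 with hd
  set u := ⨅ j, μM j with hu
  have hd0 : 0 < d := by
    obtain ⟨jk, h⟩ := exists_eq_ciInf_of_finite (f := fun jk : Fin p × Fin p => SigmaM jk.1 jk.2)
    rw [hd, ← h]
    exact hSigmaM _ _
  have hu0 : 0 < u := by
    obtain ⟨j, h⟩ := exists_eq_ciInf_of_finite (f := μM)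
    rw [hu, ← h]
    exact hμM _
  have hdle : ∀ j k, d ≤ SigmaM j k := fun j k =>
    ciInf_le (Set.finite_range fun jk : Fin p × Fin p => SigmaM jk.1 jk.2).bddBelow (j, k)
  have hule : ∀ j, u ≤ μM j := fun j => ciInf_le (Set.finite_range μM).bddBelow j
  have hs1 : (1 : ℝ) ≤ CaZnRLS.sparsity βs := by
    have : 0 < CaZnRLS.sparsity βs :=
      Finset.card_pos.mpr ⟨i₀, by simpa [CaZnRLS.supp] using hi₀⟩
    exact_mod_cast this
  have hl0 : 0 < CaZnRLS.l1norm βs :=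
    lt_of_lt_of_le (abs_pos.mpr hi₀)
      (Finset.single_le_sum (f := fun i => |βs i|) (fun _ _ => abs_nonneg _)
        (Finset.mem_univ i₀))
  have hκ := hREC.1
  have hn' : (0 : ℝ) < n := by exact_mod_cast hn
  set s : ℝ := (CaZnRLS.sparsity βs : ℝ) with hs
  have hs0 : 0 < s := by linarith
  have hcX' : ∀ i j, |X i j| ≤ |cX| + 1 := fun i j =>
    (hcX i j).trans ((le_abs_self _).trans (by linarith))
  have hcM' : ∀ᵐ ω ∂P, ∀ i j, |M ω i j| ≤ |cM| + 1 := hcM.mono fun ω h i j =>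
    (h i j).trans ((le_abs_self _).trans (by linarith))
  have hx0 : 0 < |cX| + 1 := by positivity
  have hm0 : 0 < |cM| + 1 := by positivity
  set x := |cX| + 1
  set m := |cM| + 1
  set l := CaZnRLS.l1norm βs with hl
  set v : ℝ := min (κ / 48) (epsHat / 3) with hv
  have hv0 : 0 < v := lt_min (by positivity) (by positivity)
  have hσ' : (0 : ℝ) < σ := hσ
  set ζ := CaZnRLS.rateScale (CaZnRLS.zeroExtend βs) ((τ : ℝ) ^ 2) ((σ : ℝ) ^ 2) κ
    (CaZnRLS.lambdaMin (CaZnRLS.SigmaDagger μM SigmaM)) x m d u epsHat with hζ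
  have hζeq : ζ = 1 + 2 * (x ^ 2 * m ^ 2 / d) ^ 2 / v ^ 2
      + 2 * (x * m * (x * l) / u) ^ 2 / (epsHat * l / 3) ^ 2
      + 2 * ((x * m / u) ^ 2 * (σ : ℝ) ^ 2) / (epsHat * l / 3) ^ 2 := by
    rw [hζ, CaZnRLS.rateScale, CaZnRLS.tsum_abs_zeroExtend, abs_of_nonneg (sq_nonneg (σ : ℝ))]
  have hQ1 : 0 ≤ 2 * (x ^ 2 * m ^ 2 / d) ^ 2 / v ^ 2 := by positivity
  have hQ2 : 0 ≤ 2 * (x * m * (x * l) / u) ^ 2 / (epsHat * l / 3) ^ 2 := by positivity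
  have hQ3 : 0 ≤ 2 * ((x * m / u) ^ 2 * (σ : ℝ) ^ 2) / (epsHat * l / 3) ^ 2 := by positivity
  set q : ℝ := Real.exp (-(1 * n * (s ^ 2)⁻¹ * ζ⁻¹)) with hq
  have hq0 : 0 < q := Real.exp_pos _
  have ht0 : 0 < epsHat * l / 3 := by positivity
  have hts : epsHat * l / 3 / s ≤ epsHat * l / 3 := div_le_self ht0.le hs1
  let E₁ : Fin p × Fin p → Set Ω := fun jk => {ω | v / s <
    |(CaZnRLS.SigmaHatMul (CaZnRLS.corrupted X (M ω)) μM SigmaM - CaZnRLS.gram X) jk.1 jk.2|}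
  let E₂ : Fin p → Set Ω := fun j => {ω | epsHat * l / 3 <
    |1 / (n : ℝ) * ∑ i, X i j * M ω i j * (X *ᵥ βs) i / μM j -
      1 / (n : ℝ) * ∑ i, X i j * (X *ᵥ βs) i|}
  let E₃ : Fin p → Set Ω := fun j => {ω | epsHat * l / 3 <
    |1 / (n : ℝ) * ∑ i, X i j * M ω i j / μM j * ε ω i|}
  -- The bound on `M` holds only almost surely, so this null set is removed; it uses the original
  -- `cM`, since `K̃` does.
  let E₀ : Set Ω := {ω | ¬ ∀ i j, |M ω i j| ≤ cM}
  have hMm := hM.measurable_entry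
  have hεm := hε.measurable
  have hE₁ : ∀ jk, P.real (E₁ jk) ≤ 2 * q := fun jk => by
    refine (CaZnRLS.SigmaHatMul_deviation hn hM hcM' hcX' hd0 hμM hdle
      (div_nonneg hv0.le hs0.le) jk.1 jk.2).trans ?_
    refine mul_le_mul_of_nonneg_left (Real.exp_le_exp.mpr (neg_le_neg ?_)) zero_le_two
    exact CaZnRLS.rate_le (V := (x ^ 2 * m ^ 2 / d) ^ 2)
      hn' hs0 hv0 (by positivity) le_rfl (by linarith)
  have hE₂ : ∀ j, P.real (E₂ j) ≤ 2 * q := fun j => by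
    refine (CaZnRLS.signal_deviation hn hM hcM' hcX' hu0 hule βs ht0.le j).trans ?_
    refine mul_le_mul_of_nonneg_left (Real.exp_le_exp.mpr (neg_le_neg ?_)) zero_le_two
    exact CaZnRLS.rate_le (V := (x * m * (x * l) / u) ^ 2)
      hn' hs0 ht0 (by positivity) hts (by linarith)
  have hE₃ : ∀ j, P.real (E₃ j) ≤ 2 * q := fun j => by
    refine (CaZnRLS.noise_deviation hn hM hcM' hε hMε hcX' hu0 hule ht0.le j).trans ?_
    refine mul_le_mul_of_nonneg_left (Real.exp_le_exp.mpr (neg_le_neg ?_)) zero_le_two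
    exact CaZnRLS.rate_le (V := (x * m / u) ^ 2 * (σ : ℝ) ^ 2)
      hn' hs0 ht0 (by positivity) hts (by linarith)
  have hE₀ : P.real E₀ = 0 := by
    rw [Measure.real, show P E₀ = 0 from ae_iff.mp hcM, ENNReal.toReal_zero]
  have hmE₀ : MeasurableSet E₀ := by
    refine MeasurableSet.compl (s := {ω | ∀ i j, |M ω i j| ≤ cM}) ?_
    simp only [Set.ofPred_forall]
    exact MeasurableSet.iInter fun i => MeasurableSet.iInter fun j =>
      measurableSet_le (hMm i j).abs measurable_const
  have hmE₁ : ∀ jk, MeasurableSet (E₁ jk) := fun jk => by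
    refine measurableSet_lt measurable_const (Measurable.abs ?_)
    simp only [CaZnRLS.SigmaHatMul, CaZnRLS.gram, CaZnRLS.corrupted, Matrix.sub_apply,
      Matrix.of_apply, Matrix.smul_apply, Matrix.mul_apply, Matrix.transpose_apply,
      Matrix.hadamard_apply, smul_eq_mul]
    fun_prop
  have hmE₂ : ∀ j, MeasurableSet (E₂ j) := fun j =>
    measurableSet_lt measurable_const (Measurable.abs (by fun_prop))
  have hmE₃ : ∀ j, MeasurableSet (E₃ j) := fun j =>
    measurableSet_lt measurable_const (Measurable.abs (by fun_prop))
  set F : Set Ω := E₀ ∪ (⋃ jk, E₁ jk) ∪ (⋃ j, E₂ j) ∪ ⋃ j, E₃ j with hF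
  have hmF : MeasurableSet F := ((hmE₀.union (MeasurableSet.iUnion hmE₁)).union
    (MeasurableSet.iUnion hmE₂)).union (MeasurableSet.iUnion hmE₃)
  refine ⟨Fᶜ, hmF.compl, ?_, ?_⟩
  · rw [probReal_compl_eq_one_sub hmF]
    have h1 : P.real (⋃ jk, E₁ jk) ≤ p ^ 2 * (2 * q) := by
      refine (measureReal_iUnion_fintype_le E₁).trans ((Finset.sum_le_sum fun jk _ =>
        hE₁ jk).trans_eq ?_)
      simp [sq]
    have h2 : P.real (⋃ j, E₂ j) ≤ p * (2 * q) := by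
      refine (measureReal_iUnion_fintype_le E₂).trans ((Finset.sum_le_sum fun j _ =>
        hE₂ j).trans_eq ?_)
      simp
    have h3 : P.real (⋃ j, E₃ j) ≤ p * (2 * q) := by
      refine (measureReal_iUnion_fintype_le E₃).trans ((Finset.sum_le_sum fun j _ =>
        hE₃ j).trans_eq ?_)
      simp
    have h4 : P.real F ≤ P.real E₀ + P.real (⋃ jk, E₁ jk) + P.real (⋃ j, E₂ j) +
        P.real (⋃ j, E₃ j) :=
      (measureReal_union_le _ _).trans (add_le_add_left ((measureReal_union_le _ _).trans
        (add_le_add_left (measureReal_union_le _ _) _)) _)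
    have h5 : (p : ℝ) * (2 * q) ≤ p ^ 2 * (2 * q) :=
      mul_le_mul_of_nonneg_right (le_self_pow₀ (by exact_mod_cast hp) two_ne_zero)
        (by positivity)
    linarith
  · intro ω hω a lam ρ w β hrun hlam hρ
    simp only [hF, Set.mem_compl_iff, Set.mem_union, Set.mem_iUnion, not_or, not_exists] at hω
    obtain ⟨⟨⟨h0, h1⟩, h2⟩, h3⟩ := hω
    exact hrun.error_bound_of_deviation_le hn hβs (hM.isHermitian hn) heps hnorm (not_not.mp h0)
      hREC (fun j k => not_lt.mp (h1 (j, k))) (fun j => not_lt.mp (h2 j))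
      (fun j => not_lt.mp (h3 j)) hlam hρ
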